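/- Let $(M,g)$ be a compact Riemannian manifold (smooth, without boundary), and let $\Psi^0(M)$ be the space of classical (polyhomogeneous) pseudodifferential operators of order $0$ on $M$, acting on $L^2(M)$. For $A\in\Psi^0(M)$ let $\sigma_A$ be its principal symbol, and let $\omega(A)=\int_{S^*M}\sigma_A\,d\mu_L$, where $\mu_L$ is the Liouville measure on the unit cosphere bundle $S^*M$, normalized to total mass one. Let $(\mathcal H_N)_{N\ge 1}$ be a sequence of finite-dimensional subspaces of $L^2(M)$ with $d_N=\dim\mathcal H_N\to\infty$, let $\Pi_N$ be the orthogonal projection of $L^2(M)$ onto $\mathcal H_N$, and suppose that $$\frac1{d_N}\operatorname{Tr}\,\Pi_N A\Pi_N=\omega(A)+o(1)\quad (N\to\infty)\qquad\text{for every }A\in\Psi^0(M).$$ Fix an orthonormal basis $(e_{N,i})_{i=1}^{d_N}$ of each $\mathcal H_N$. A sequence of unitary matrices $U_N\in U(d_N)$ defines the orthonormal bases $\psi_{N,j}=\sum_i (U_N)_{ij}\,e_{N,i}$ $(1\le j\le d_N)$ of the spaces $\mathcal H_N$; so the product of the unit-mass Haar measures on $\prod_N U(d_N)$ defines a random orthonormal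 basis of $\bigoplus_N\mathcal H_N$. Then this random orthonormal basis is almost surely quantum ergodic: with probability one, $$\lim_{N\to\infty}\frac1N\sum_{n=1}^N\ \frac1{d_n}\sum_{j=1}^{d_n}\bigl|\langle A\psi_{n,j},\psi_{n,j}\rangle-\omega(A)\bigr|^2=0\qquad\text{for all }A\in\Psi^0(M).$$ -/

import Mathlib

open MeasureTheory Filter Topology
open scoped Manifold ContDiff SchwartzMap FourierTransform

namespace RandomONB

/-! ### Riemannian geometry: volume and unit cospheres -/

/-- The coordinate space `ℝⁿ` with its Euclidean norm. -/
abbrev Euc (n : ℕ) : Type := EuclideanSpace ℝ (Fin n)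

section Geometry

variable {n : ℕ} {M : Type*} [TopologicalSpace M] [ChartedSpace (Euc n) M] [IsManifold (𝓡 n) ∞ M]

variable (n M) in
/-- Smooth Riemannian metrics on the smooth `n`-manifold `M`. -/
abbrev RiemMetric : Type _ :=
  Bundle.ContMDiffRiemannianMetric (𝓡 n) ∞ (Euc n) (fun p : M => TangentSpace (𝓡 n) p)

/-- The smooth charts of `M`. The domain of a chart is any open subset of `M` that is
diffeomorphic to an open subset of `ℝⁿ`; it need not be connected. -/
abbrev charts (n : ℕ) (M : Type*) [TopologicalSpace M] [ChartedSpace (Euc n) M] :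
    Set (OpenPartialHomeomorph M (Euc n)) :=
  IsManifold.maximalAtlas (𝓡 n) ∞ M

/-- The coordinate vector field `∂ᵢ` of the chart `e`, at the point with coordinates `x`. -/
noncomputable def coordVector (e : OpenPartialHomeomorph M (Euc n)) (x : Euc n) (i : Fin n) :
    TangentSpace (𝓡 n) (e.symm x) :=
  mfderiv (𝓡 n) (𝓡 n) e.symm x (EuclideanSpace.single i (1 : ℝ) : Euc n)

/-- The Gram matrix `gᵢⱼ = g(∂ᵢ, ∂ⱼ)` of the metric in the chart `e`. -/
noncomputable def gramMatrix (g : RiemMetric n M) (e : OpenPartialHomeomorph M (Euc n)) (x : Euc n) :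
    Matrix (Fin n) (Fin n) ℝ :=
  Matrix.of fun i j => g.inner (e.symm x) (coordVector e x i) (coordVector e x j)

/-- The cotangent space `T*ₚM`. -/
abbrev Cotangent (n : ℕ) {M : Type*} [TopologicalSpace M] [ChartedSpace (Euc n) M] (p : M) :
    Type _ :=
  TangentSpace (𝓡 n) p →L[ℝ] ℝ

/-- The covector `∑ ξᵢ dxⁱ` at `p` in the coordinates `(x¹, …, xⁿ)` of the chart `e`. -/
noncomputable def covector (e : OpenPartialHomeomorph M (Euc n)) (p : M) (ξ : Euc n) :
    Cotangent n p :=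
  (innerSL ℝ ξ : Euc n →L[ℝ] ℝ).comp (mfderiv (𝓡 n) (𝓡 n) e p : TangentSpace (𝓡 n) p →L[ℝ] Euc n)

/-- The norm on `T*ₚM` dual to the norm that `g` defines on `TₚM`. -/
noncomputable def conorm (g : RiemMetric n M) (p : M) (η : Cotangent n p) : ℝ :=
  sSup ((fun v : TangentSpace (𝓡 n) p => η v) '' {v | g.inner p v v ≤ 1})

/-- The average of a function `f` on `T*ₚM` over the unit cosphere `S*ₚM = {η | |η|_g = 1}`,
for the uniform (rotation invariant) probability measure of `S*ₚM`. This measure is the image of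
the normalized Lebesgue measure of the punctured unit ball of `T*ₚM` under `η ↦ η / |η|_g`. -/
noncomputable def cosphereAverage (g : RiemMetric n M) (p : M) (f : Cotangent n p → ℂ) : ℂ :=
  ⨍ ξ in {ξ : Euc n | 0 < conorm g p (covector (chartAt (Euc n) p) p ξ) ∧
      conorm g p (covector (chartAt (Euc n) p) p ξ) ≤ 1},
    f ((conorm g p (covector (chartAt (Euc n) p) p ξ))⁻¹ • covector (chartAt (Euc n) p) p ξ)

variable [MeasurableSpace M]

/-- The measure `√(det g) dx` on the domain of the chart `e`, as a measure on `M`. -/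
noncomputable def chartVolume (g : RiemMetric n M) (e : OpenPartialHomeomorph M (Euc n)) : Measure M :=
  ((volume.restrict e.target).withDensity
    fun x => ENNReal.ofReal (Real.sqrt (gramMatrix g e x).det)).map e.symm

/-- The Riemannian volume measure: the least measure that dominates `√(det g) dx` on every
chart domain. (On overlaps the chart measures agree, so the restriction of this measure to a chart
domain is the chart measure.) -/
noncomputable def vol (g : RiemMetric n M) : Measure M :=
  ⨆ e ∈ charts n M, chartVolume g e

/-- The complex Hilbert space `L²(M)` of the Riemannian volume. -/
abbrev L2 (g : RiemMetric n M) : Type _ := Lp ℂ 2 (vol g)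

/-- The integral over the unit cosphere bundle `S*M` of a function `σ` against the Liouville
measure of total mass one, that is, the Riemannian volume on `M` (normalized) times the uniform
probability measures on the fibres `S*ₚM`. -/
noncomputable def liouvilleIntegral (g : RiemMetric n M) (σ : (p : M) → Cotangent n p → ℂ) : ℂ :=
  ⨍ p, cosphereAverage g p (σ p) ∂(vol g)

end Geometry

/-! ### Pseudodifferential operators of order zero -/

/-- The estimates of a symbol of order `m`, uniform in `x ∈ ℝⁿ` and `ξ ∈ S`:
`|∂_ξ^β ∂_x^α b(x, ξ)| ≤ C (1 + |ξ|)^(m - |β|)` for all `|α| = k`, `|β| = l`. -/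
def SymbolEstimates {n : ℕ} (m : ℤ) (S : Set (Euc n)) (b : Euc n → Euc n → ℂ) : Prop :=
  ∀ k l : ℕ, ∃ C : ℝ, ∀ x : Euc n, ∀ ξ ∈ S,
    ‖iteratedFDeriv ℝ l (fun η => iteratedFDeriv ℝ k (fun y => b y η) x) ξ‖
      ≤ C * (1 + ‖ξ‖) ^ (m - l)

/-- Classical (polyhomogeneous) symbols of order zero on `ℝⁿ × ℝⁿ`: the smooth `a(x, ξ)` in
`S⁰` with an asymptotic expansion `a ~ ∑ⱼ aⱼ`, where `aⱼ` is smooth on `ξ ≠ 0` and positively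
homogeneous of degree `-j` in `ξ`, and `a - ∑_{j < J} aⱼ` satisfies the estimates of a symbol of
order `-J` for `|ξ| ≥ 1`. -/
structure IsClassicalSymbol {n : ℕ} (a : Euc n → Euc n → ℂ) : Prop where
  smooth : ContDiff ℝ ∞ (fun z : Euc n × Euc n => a z.1 z.2)
  estimates : SymbolEstimates 0 Set.univ a
  expansion : ∃ aj : ℕ → Euc n → Euc n → ℂ,
    (∀ j, ContDiffOn ℝ ∞ (fun z : Euc n × Euc n => aj j z.1 z.2) {z | z.2 ≠ 0}) ∧
    (∀ j x ξ, ξ ≠ 0 → ∀ t : ℝ, 0 < t → aj j x (t • ξ) = ((t : ℂ) ^ j)⁻¹ * aj j x ξ) ∧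
    (∀ J : ℕ, SymbolEstimates (-(J : ℤ)) {ξ : Euc n | 1 ≤ ‖ξ‖}
      (fun x ξ => a x ξ - ∑ j ∈ Finset.range J, aj j x ξ))

/-- The Kohn–Nirenberg quantization
`Op(a)u(x) = (2π)⁻ⁿ ∫ e^{i⟨x,ξ⟩} a(x, ξ) û(ξ) dξ`, `û(ξ) = ∫ e^{-i⟨y,ξ⟩} u(y) dy`.
It is written with Mathlib's Fourier transform `𝓕 u(ξ) = û(2πξ)`, after the substitution
`ξ ↦ 2πξ`. -/
noncomputable def Op {n : ℕ} (a : Euc n → Euc n → ℂ) (u : 𝓢(Euc n, ℂ)) (x : Euc n) : ℂ :=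
  ∫ ξ : Euc n, Complex.exp (2 * Real.pi * Complex.I * (inner ℝ x ξ : ℝ)) *
    a x ((2 * Real.pi) • ξ) * 𝓕 (fun y => u y) ξ

/-- `φ` is a smooth function on `ℝⁿ` whose support is a compact subset of `V`. -/
structure IsCutoff {n : ℕ} (V : Set (Euc n)) (φ : Euc n → ℂ) : Prop where
  smooth : ContDiff ℝ ∞ φ
  compact : HasCompactSupport φ
  subset : tsupport φ ⊆ V

section Psi

variable {n : ℕ} {M : Type*} [TopologicalSpace M] [ChartedSpace (Euc n) M] [IsManifold (𝓡 n) ∞ M]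
  [MeasurableSpace M]

/-- The function `w ∘ e` on the domain of the chart `e`, extended by zero to `M`. -/
noncomputable def pullback (e : OpenPartialHomeomorph M (Euc n)) (w : Euc n → ℂ) : M → ℂ :=
  Set.indicator e.source (fun p => w (e p))

/-- In the coordinates of the chart `e`, the operator `φ A ψ` is `Op(a)`:
`φ · (A f) ∘ e⁻¹ = Op(a) u` on `ℝⁿ`, where `f ∈ L²(M)` is the function `(ψ u) ∘ e`, extended by
zero. -/
def IsLocalSymbol (g : RiemMetric n M) (A : L2 g →L[ℂ] L2 g) (e : OpenPartialHomeomorph M (Euc n))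
    (φ ψ : Euc n → ℂ) (a : Euc n → Euc n → ℂ) : Prop :=
  IsClassicalSymbol a ∧
  ∀ u : 𝓢(Euc n, ℂ), ∀ f : L2 g, f =ᵐ[vol g] pullback e (fun x => ψ x * u x) →
    ∀ᵐ x ∂(volume : Measure (Euc n)), φ x * (A f : M → ℂ) (e.symm x) = Op a u x

/-- The space `Ψ⁰(M)` of classical pseudodifferential operators of order zero, acting on `L²(M)`:
`A ∈ Ψ⁰(M)` when `φ A ψ` is, in every chart and for all smooth cutoffs `φ`, `ψ` with compact
support in the chart, the quantization of a classical symbol of order zero. (As charts are not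
required to be connected, two distinct points always lie in a common chart, and the condition
contains the smoothness of the kernel of `A` off the diagonal.) -/
def Psi0 (g : RiemMetric n M) : Set (L2 g →L[ℂ] L2 g) :=
  {A | ∀ e ∈ charts n M, ∀ φ ψ : Euc n → ℂ, IsCutoff e.target φ → IsCutoff e.target ψ →
    ∃ a, IsLocalSymbol g A e φ ψ a}

/-- `c` is the value at the covector `η ∈ T*ₚM` of the principal symbol of `A`: in every chart
around `p`, the leading homogeneous part `a₀(x, ξ) = lim_{t → ∞} a(x, t ξ)` of the symbol of
`φ A ψ` is `φ(x) ψ(x) c` at the coordinates `(x, ξ)` of `(p, η)`. -/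
def IsPrincipalSymbolAt (g : RiemMetric n M) (A : L2 g →L[ℂ] L2 g) (p : M) (η : Cotangent n p)
    (c : ℂ) : Prop :=
  ∀ e ∈ charts n M, p ∈ e.source → ∀ (φ ψ : Euc n → ℂ) (a : Euc n → Euc n → ℂ),
    IsCutoff e.target φ → IsCutoff e.target ψ → IsLocalSymbol g A e φ ψ a →
    ∀ ξ : Euc n, covector e p ξ = η →
      Tendsto (fun t : ℝ => a (e p) (t • ξ)) atTop (𝓝 (φ (e p) * ψ (e p) * c))

/-- The principal symbol `σ_A` of `A ∈ Ψ⁰(M)`, a function on `T*M ∖ 0`. -/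
noncomputable def principalSymbol (g : RiemMetric n M) (A : L2 g →L[ℂ] L2 g) (p : M)
    (η : Cotangent n p) : ℂ :=
  Classical.epsilon (IsPrincipalSymbolAt g A p η)

/-- The Liouville state `ω(A) = ∫_{S*M} σ_A dμ_L`. -/
noncomputable def liouvilleState (g : RiemMetric n M) (A : L2 g →L[ℂ] L2 g) : ℂ :=
  liouvilleIntegral g (principalSymbol g A)

end Psi

/-! ### Random orthonormal bases -/

section Unitary

noncomputable instance (d : ℕ) : MeasurableSpace (Matrix.unitaryGroup (Fin d) ℂ) := borel _

instance (d : ℕ) : BorelSpace (Matrix.unitaryGroup (Fin d) ℂ) := ⟨rfl⟩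

instance (d : ℕ) : CompactSpace (Matrix.unitaryGroup (Fin d) ℂ) := by
  refine isCompact_iff_compactSpace.mp ?_
  have hK : IsCompact (X := Matrix (Fin d) (Fin d) ℂ) (Set.univ.pi fun _ : Fin d =>
      Set.univ.pi fun _ : Fin d => Metric.closedBall (0 : ℂ) 1) :=
    isCompact_univ_pi fun _ => isCompact_univ_pi fun _ => isCompact_closedBall _ _
  refine hK.of_isClosed_subset ?_ ?_
  · have : (Matrix.unitaryGroup (Fin d) ℂ : Set (Matrix (Fin d) (Fin d) ℂ)) =
        {A | A * star A = 1} := by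
      ext A
      exact Matrix.mem_unitaryGroup_iff
    rw [this]
    exact isClosed_eq (continuous_id.mul continuous_star) continuous_const
  · intro A hA i _ j _
    simpa using entry_norm_bound_of_unitary hA i j

/-- The Haar measure of total mass one on `U(d)`. -/
noncomputable def haarUnitary (d : ℕ) : Measure (Matrix.unitaryGroup (Fin d) ℂ) :=
  Measure.haarMeasure ⊤

instance (d : ℕ) : IsProbabilityMeasure (haarUnitary d) :=
  ⟨Measure.haarMeasure_self (K₀ := ⊤)⟩

variable {H : Type*} [NormedAddCommGroup H] [InnerProductSpace ℂ H] {d : ℕ}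

theorem orthonormal_rotate (e : OrthonormalBasis (Fin d) ℂ H)
    (U : Matrix.unitaryGroup (Fin d) ℂ) : Orthonormal ℂ (fun j => ∑ i, U.1 i j • e i) := by
  rw [orthonormal_iff_ite]
  intro j k
  have h := congrFun (congrFun (Matrix.mem_unitaryGroup_iff'.mp U.2) j) k
  rw [e.orthonormal.inner_sum]
  simpa [Matrix.mul_apply, Matrix.star_apply, Matrix.one_apply] using h

/-- The orthonormal basis `ψⱼ = ∑ᵢ Uᵢⱼ eᵢ` that the unitary matrix `U` makes from the orthonormal
basis `e`. Every orthonormal basis indexed in the same way is of this form for exactly one `U`. -/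
noncomputable def rotate (e : OrthonormalBasis (Fin d) ℂ H) (U : Matrix.unitaryGroup (Fin d) ℂ) :
    OrthonormalBasis (Fin d) ℂ H :=
  OrthonormalBasis.mk (orthonormal_rotate e U) (by
    have := e.toBasis.finiteDimensional_of_finite
    exact ((orthonormal_rotate e U).linearIndependent.span_eq_top_of_card_eq_finrank'
      (by rw [Module.finrank_eq_card_basis e.toBasis])).ge)

end Unitary

section QuantumErgodic

variable {n : ℕ} {M : Type*} [TopologicalSpace M] [ChartedSpace (Euc n) M] [IsManifold (𝓡 n) ∞ M]
  [MeasurableSpace M]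

/-- The compression `Π A Π` of `A` to the finite-dimensional subspace `V` of `L²(M)`, where `Π` is
the orthogonal projection onto `V`. -/
noncomputable def compression {g : RiemMetric n M} (V : Submodule ℂ (L2 g)) [FiniteDimensional ℂ V]
    (A : L2 g →L[ℂ] L2 g) : V →ₗ[ℂ] V :=
  ((V.orthogonalProjectionOnto.comp A).comp V.subtypeL : V →L[ℂ] V)

/-- Local Weyl asymptotics: `(1 / d_N) Tr Π_N A Π_N = ω(A) + o(1)` for every `A ∈ Ψ⁰(M)`. -/
def LocalWeyl (g : RiemMetric n M) (V : ℕ → Submodule ℂ (L2 g)) [∀ N, FiniteDimensional ℂ (V N)] :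
    Prop :=
  ∀ A ∈ Psi0 g, Tendsto
    (fun N => (Module.finrank ℂ (V N) : ℂ)⁻¹ * LinearMap.trace ℂ (V N) (compression (V N) A))
    atTop (𝓝 (liouvilleState g A))

/-- The quantum variance `(1 / d) ∑ⱼ |⟨A ψⱼ, ψⱼ⟩ - ω(A)|²` of an orthonormal basis of a subspace
of dimension `d`. (Mathlib's inner product is linear in its second argument.) -/
noncomputable def quantumVariance {g : RiemMetric n M} {V : Submodule ℂ (L2 g)} {d : ℕ}
    (ψ : OrthonormalBasis (Fin d) ℂ V) (A : L2 g →L[ℂ] L2 g) : ℝ :=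
  (d : ℝ)⁻¹ * ∑ j, ‖inner ℂ (ψ j : L2 g) (A (ψ j : L2 g)) - liouvilleState g A‖ ^ 2

/-- A sequence of orthonormal bases is quantum ergodic when, for every `A ∈ Ψ⁰(M)`, the Cesàro
means of its quantum variances tend to zero. -/
def IsQuantumErgodic {g : RiemMetric n M} {V : ℕ → Submodule ℂ (L2 g)} {d : ℕ → ℕ}
    (ψ : ∀ N, OrthonormalBasis (Fin (d N)) ℂ (V N)) : Prop :=
  ∀ A ∈ Psi0 g, Tendsto
    (fun N : ℕ => (N : ℝ)⁻¹ * ∑ k ∈ Finset.range N, quantumVariance (ψ k) A) atTop (𝓝 0)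

end QuantumErgodic

end RandomONB

/-! Fix `A`, and let `B` be the matrix of `Π A Π` in the given basis of a space of dimension `d`.
Then `⟨A ψⱼ, ψⱼ⟩` is the quadratic form of `B` at the `j`-th column of a Haar unitary matrix. Its
mean square deviation from `tr B / d` is at most `‖B‖²_HS / (d (d + 1)) ≤ ‖A‖² / (d + 1)`
(`integral_sq_columnForm`), and `tr B / d` tends to `ω(A)` by the local Weyl hypothesis. So the
expected quantum variance tends to zero along the sequence (`integral_quantumVariance_le`). The
quantum variances of different levels are independent and uniformly bounded, and a strong law makes
their Cesàro means tend to zero almost surely (`ae_tendsto_average_of_bounded`).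

The exceptional null set depends on `A`, so a countable subset of `Ψ⁰(M)`, dense in operator norm,
is needed. Normalized traces of compressions are contractive in operator norm, so the Weyl
hypothesis itself makes `ω` 1-Lipschitz on `Ψ⁰(M)` (`norm_liouvilleState_sub_le`), and convergence
passes from the dense subset to all of `Ψ⁰(M)`. Nothing else about `ω` enters, and no symbol
calculus.

The analysis lies in the separability of `Ψ⁰(M)` (`isSeparable_Psi0`). If a symbol has compact
support in `x`, the `L²` norm of its quantization is controlled by the sup norms of its
`x`-derivatives up to order `n + 1` (`exists_eLpNorm_Op_le`). A classical symbol approaches its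
degree-zero part at rate `1 / |ξ|`, so up to a small error it is determined by its values on a large
ball in `ξ`. There its derivatives lie in spaces of continuous functions on a compact set, which are
separable. A finite partition of `M`, any two pieces of which lie in a common, possibly
disconnected, chart, reduces an operator on `M` to finitely many such local pieces, the off-diagonal
ones included. -/

namespace RandomONB

set_option linter.unusedSectionVars false

/-! ### Fourth moments of a column of a Haar unitary matrix. -/

section HaarMoments

variable {d : ℕ}

theorem continuous_normSq_entry (i j : Fin d) :
    Continuous fun U : Matrix.unitaryGroup (Fin d) ℂ => Complex.normSq (U.1 i j) :=
  Complex.continuous_normSq.comp ((continuous_apply_apply i j).comp continuous_subtype_val)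

theorem integrable_haarUnitary {E : Type*} [NormedAddCommGroup E]
    {f : Matrix.unitaryGroup (Fin d) ℂ → E} (hf : Continuous f) :
    Integrable f (haarUnitary d) :=
  hf.integrable_of_hasCompactSupport (HasCompactSupport.of_compactSpace f)

instance : (haarUnitary d).IsMulLeftInvariant :=
  inferInstanceAs (Measure.haarMeasure ⊤).IsMulLeftInvariant

theorem sum_normSq_column (U : Matrix.unitaryGroup (Fin d) ℂ) (j : Fin d) :
    ∑ i, Complex.normSq (U.1 i j) = 1 := by
  have h := congrFun (congrFun (Matrix.mem_unitaryGroup_iff'.mp U.2) j) j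
  simp only [Matrix.mul_apply, Matrix.star_apply, Matrix.one_apply_eq] at h
  have h2 : ((∑ i, Complex.normSq (U.1 i j) : ℝ) : ℂ) = 1 := by
    rw [← h]
    push_cast
    exact Finset.sum_congr rfl fun i _ => by
      rw [Complex.normSq_eq_conj_mul_self]; rfl
  exact_mod_cast h2

/-- For `i ≠ k` and `|c| = 1` the reflection along `eᵢ + 2c eₖ` mixes rows `i` and `k`. -/
theorem exists_unitary_mix {i k : Fin d} (hik : i ≠ k) (c : ℂ) (hc : Complex.normSq c = 1) :
    ∃ W : Matrix.unitaryGroup (Fin d) ℂ, ∀ (U : Matrix.unitaryGroup (Fin d) ℂ) (j : Fin d),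
      (W * U).1 i j = (3 / 5 : ℂ) * U.1 i j - (4 / 5 : ℂ) * star c * U.1 k j := by
  classical
  set w : Fin d → ℂ := Pi.single i 1 + Pi.single k (2 * c) with hw
  have hcc : star c * c = 1 := by
    have := Complex.normSq_eq_conj_mul_self (z := c)
    rw [hc] at this
    exact_mod_cast this.symm
  have hww : star w ⬝ᵥ w = 5 := by
    have h1 : star w ⬝ᵥ w = 1 + 4 * (star c * c) := by
      simp [hw, dotProduct_add, hik, hik.symm]
      ring
    rw [h1, hcc]
    norm_num
  set P : Matrix (Fin d) (Fin d) ℂ := Matrix.vecMulVec w (star w) with hP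
  have hPP : P * P = (5 : ℂ) • P := by
    rw [hP, Matrix.vecMulVec_mul_vecMulVec, hww, Matrix.vecMulVec_smul]
  have hPs : star P = P := by
    rw [hP, Matrix.star_eq_conjTranspose, Matrix.conjTranspose_vecMulVec, star_star]
  -- Since `‖w‖² = 5`, this is `1 - 2ww* / ‖w‖²`. The choice of `w` keeps the mixing coefficients
  -- `3/5` and `4/5` rational.
  have hmem : (1 - (2 / 5 : ℂ) • P) ∈ Matrix.unitaryGroup (Fin d) ℂ := by
    rw [Matrix.mem_unitaryGroup_iff]
    have hs : star (1 - (2 / 5 : ℂ) • P) = 1 - (2 / 5 : ℂ) • P := by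
      rw [star_sub, star_one, star_smul, hPs]
      congr 2
      simp
    rw [hs]
    simp only [sub_mul, mul_sub, one_mul, mul_one, Matrix.smul_mul, Matrix.mul_smul, hPP, smul_smul]
    module
  refine ⟨⟨_, hmem⟩, fun U j => ?_⟩
  change ((1 - (2 / 5 : ℂ) • P) * U.1) i j = _
  rw [sub_mul, one_mul, Matrix.smul_mul, Matrix.sub_apply, Matrix.smul_apply, hP,
    Matrix.vecMulVec_mul, Matrix.vecMulVec_apply]
  have h1 : w i = 1 := by simp [hw, hik]
  have h2 : Matrix.vecMul (star w) U.1 j = U.1 i j + 2 * star c * U.1 k j := by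
    simp [hw, Matrix.vecMul, add_dotProduct, single_dotProduct]
  rw [h1, h2, smul_eq_mul]
  ring

/-- The mixed second moments of the squared entries of a column of a random unitary matrix. -/
noncomputable def columnMoment (j i k : Fin d) : ℝ :=
  ∫ U, Complex.normSq (U.1 i j) * Complex.normSq (U.1 k j) ∂(haarUnitary d)

theorem columnMoment_comm (j i k : Fin d) : columnMoment j i k = columnMoment j k i := by
  simp only [columnMoment, mul_comm]

theorem integrable_columnMoment (j i k : Fin d) :
    Integrable (fun U : Matrix.unitaryGroup (Fin d) ℂ =>
      Complex.normSq (U.1 i j) * Complex.normSq (U.1 k j)) (haarUnitary d) :=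
  integrable_haarUnitary ((continuous_normSq_entry i j).mul (continuous_normSq_entry k j))

/-- By left invariance, row `i` may be replaced by `3a/5 - 4c̄b/5` for any phase `c`. The average of
`|x - c̄y|⁴` over `c = ±1, ±i` is `|x|⁴ + |y|⁴ + 4|x|²|y|²`, because the cross term averages to zero
and its square to `2|x|²|y|²`. -/
theorem columnMoment_mix (j : Fin d) {i k : Fin d} (hik : i ≠ k) :
    columnMoment j i i = 81 / 625 * columnMoment j i i + 256 / 625 * columnMoment j k k
      + 576 / 625 * columnMoment j i k := by
  have key : ∀ c : ℂ, Complex.normSq c = 1 → columnMoment j i i =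
      ∫ U : Matrix.unitaryGroup (Fin d) ℂ,
        Complex.normSq ((3 / 5 : ℂ) * U.1 i j - (4 / 5 : ℂ) * star c * U.1 k j) ^ 2
        ∂(haarUnitary d) := by
    intro c hc
    obtain ⟨W, hW⟩ := exists_unitary_mix hik c hc
    have := integral_mul_left_eq_self (μ := haarUnitary d)
      (fun U : Matrix.unitaryGroup (Fin d) ℂ =>
        Complex.normSq (U.1 i j) * Complex.normSq (U.1 i j)) W
    rw [columnMoment, ← this]
    simp only [hW, sq]
  have hint : ∀ c : ℂ, Integrable (fun U : Matrix.unitaryGroup (Fin d) ℂ =>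
        Complex.normSq ((3 / 5 : ℂ) * U.1 i j - (4 / 5 : ℂ) * star c * U.1 k j) ^ 2)
        (haarUnitary d) := by
    intro c
    refine integrable_haarUnitary ((Complex.continuous_normSq.comp ?_).pow 2)
    have h1 : ∀ i j, Continuous fun U : Matrix.unitaryGroup (Fin d) ℂ => U.1 i j :=
      fun i j => (continuous_apply_apply i j).comp continuous_subtype_val
    exact (continuous_const.mul (h1 i j)).sub (continuous_const.mul (h1 k j))
  set F : ℂ → Matrix.unitaryGroup (Fin d) ℂ → ℝ := fun c U =>
    Complex.normSq ((3 / 5 : ℂ) * U.1 i j - (4 / 5 : ℂ) * star c * U.1 k j) ^ 2 with hF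
  have hadd : ∫ U, (F 1 U + F (-1) U + (F Complex.I U + F (-Complex.I) U)) ∂(haarUnitary d) =
      4 * columnMoment j i i := by
    have h := (integral_add ((hint 1).add (hint (-1)))
      ((hint Complex.I).add (hint (-Complex.I)))).trans (congrArg₂ (· + ·)
        (integral_add (hint 1) (hint (-1))) (integral_add (hint Complex.I) (hint (-Complex.I))))
    rw [← key 1 (by simp), ← key (-1) (by simp), ← key Complex.I (by simp),
      ← key (-Complex.I) (by simp)] at h
    exact h.trans (by ring)
  have hexp : ∀ U : Matrix.unitaryGroup (Fin d) ℂ,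
      F 1 U + F (-1) U + (F Complex.I U + F (-Complex.I) U) =
      4 * (81 / 625 * (Complex.normSq (U.1 i j) * Complex.normSq (U.1 i j)) +
        256 / 625 * (Complex.normSq (U.1 k j) * Complex.normSq (U.1 k j)) +
        576 / 625 * (Complex.normSq (U.1 i j) * Complex.normSq (U.1 k j))) := by
    intro U
    simp only [hF]
    generalize U.1 i j = a
    generalize U.1 k j = b
    simp [Complex.normSq_apply]
    ring
  have hii := (integrable_columnMoment j i i).const_mul (81 / 625)
  have hkk := (integrable_columnMoment j k k).const_mul (256 / 625)
  have hik' := (integrable_columnMoment j i k).const_mul (576 / 625)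
  have h4 : ∫ U, (F 1 U + F (-1) U + (F Complex.I U + F (-Complex.I) U)) ∂(haarUnitary d) =
      4 * (81 / 625 * columnMoment j i i + 256 / 625 * columnMoment j k k
      + 576 / 625 * columnMoment j i k) := by
    simp_rw [hexp]
    rw [integral_const_mul]
    congr 1
    refine (integral_add (hii.add hkk) hik').trans (congrArg₂ (· + ·)
      ((integral_add hii hkk).trans (congrArg₂ (· + ·) ?_ ?_)) ?_) <;>
    exact integral_const_mul _ _
  linarith

/-- The mixing relation and the one with `i` and `k` exchanged share the same mixed moment; their
difference leaves only the diagonal moments. -/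
theorem columnMoment_diag_eq (j i k : Fin d) : columnMoment j i i = columnMoment j k k := by
  by_cases h : i = k
  · rw [h]
  · have h1 := columnMoment_mix j h
    have h2 := columnMoment_mix j (Ne.symm h)
    rw [columnMoment_comm j k i] at h2
    linarith

/-- With equal diagonal moments, the mixing relation makes each off-diagonal moment half of a
diagonal one. The scale follows from the unit length of the column: all `d²` moments sum to one, and
the weights `2` and `1` sum to `d (d + 1)`. -/
theorem columnMoment_eq (j i k : Fin d) :
    columnMoment j i k = (if i = k then 2 else 1) / ((d : ℝ) * (d + 1)) := by
  have hd : 0 < (d : ℝ) := by exact_mod_cast Fin.pos j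
  have hoff : ∀ a b, columnMoment j a b = (if a = b then 2 else 1) * (columnMoment j j j / 2) := by
    intro a b
    split_ifs with h
    · rw [h, columnMoment_diag_eq j b j]; ring
    · have h1 := columnMoment_mix j h
      rw [columnMoment_diag_eq j a j, columnMoment_diag_eq j b j] at h1
      linarith
  have hsum : ∑ a, ∑ b, columnMoment j a b = 1 := by
    simp only [columnMoment]
    simp_rw [← integral_finsetSum _ fun (b : Fin d) _ => integrable_columnMoment j _ b]
    rw [← integral_finsetSum _ fun (a : Fin d) _ =>
      integrable_finsetSum _ fun (b : Fin d) _ => integrable_columnMoment j a b]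
    simp_rw [← Finset.sum_mul_sum, sum_normSq_column]
    simp
  have hcount : ∑ a : Fin d, ∑ b : Fin d, (if a = b then (2 : ℝ) else 1) = d * (d + 1) := by
    have : ∀ a b : Fin d, (if a = b then (2 : ℝ) else 1) = 1 + if a = b then 1 else 0 := by
      intro a b; split_ifs <;> norm_num
    simp_rw [this, Finset.sum_add_distrib, Finset.sum_ite_eq, Finset.mem_univ, if_true,
      Finset.sum_const, Finset.card_univ, Fintype.card_fin, nsmul_eq_mul]
    ring
  rw [Finset.sum_congr rfl fun a _ => Finset.sum_congr rfl fun b _ => hoff a b] at hsum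
  simp_rw [← Finset.sum_mul, hcount] at hsum
  rw [hoff, div_eq_mul_inv _ ((d : ℝ) * (d + 1))]
  congr 1
  exact eq_inv_of_mul_eq_one_right hsum

end HaarMoments

/-! ### Variance of a quadratic form at a random column. -/

section QuadraticForm

variable {d : ℕ}

/-- The value `u* B u` of the quadratic form of `B` at the `j`-th column `u` of `U`. -/
noncomputable def columnForm (B : Matrix (Fin d) (Fin d) ℂ) (j : Fin d)
    (U : Matrix.unitaryGroup (Fin d) ℂ) : ℂ :=
  (star U.1 * B * U.1) j j

theorem continuous_columnForm (B : Matrix (Fin d) (Fin d) ℂ) (j : Fin d) :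
    Continuous (columnForm B j) := by
  have h : Continuous fun U : Matrix.unitaryGroup (Fin d) ℂ => star U.1 * B * U.1 :=
    (continuous_subtype_val.star.mul continuous_const).mul continuous_subtype_val
  exact (continuous_apply_apply j j).comp h

theorem columnForm_diagonal (c : Fin d → ℝ) (j : Fin d) (U : Matrix.unitaryGroup (Fin d) ℂ) :
    columnForm (Matrix.diagonal (fun i => (c i : ℂ))) j U =
      ((∑ i, c i * Complex.normSq (U.1 i j) : ℝ) : ℂ) := by
  rw [columnForm, Matrix.mul_apply]
  push_cast
  refine Finset.sum_congr rfl fun i _ => ?_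
  rw [Matrix.mul_diagonal, Matrix.star_apply, Complex.normSq_eq_conj_mul_self]
  change (starRingEnd ℂ) _ * _ * _ = _
  ring

theorem integral_sq_diagonal (c : Fin d → ℝ) (j : Fin d) :
    ∫ U : Matrix.unitaryGroup (Fin d) ℂ, (∑ i, c i * Complex.normSq (U.1 i j)) ^ 2
      ∂(haarUnitary d) = ((∑ i, c i) ^ 2 + ∑ i, c i ^ 2) / ((d : ℝ) * (d + 1)) := by
  have hexp : ∀ U : Matrix.unitaryGroup (Fin d) ℂ, (∑ i, c i * Complex.normSq (U.1 i j)) ^ 2 =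
      ∑ i, ∑ k, (c i * c k) * (Complex.normSq (U.1 i j) * Complex.normSq (U.1 k j)) := by
    intro U
    rw [sq, Finset.sum_mul_sum]
    exact Finset.sum_congr rfl fun i _ => Finset.sum_congr rfl fun k _ => by ring
  simp_rw [hexp]
  rw [integral_finsetSum _ fun i _ => integrable_finsetSum _ fun k _ =>
    (integrable_columnMoment j i k).const_mul (c i * c k)]
  have h1 : ∀ i, ∫ U : Matrix.unitaryGroup (Fin d) ℂ, ∑ k, (c i * c k) *
      (Complex.normSq (U.1 i j) * Complex.normSq (U.1 k j)) ∂(haarUnitary d) =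
      ∑ k, (c i * c k) * columnMoment j i k := by
    intro i
    rw [integral_finsetSum _ fun k _ =>
      (integrable_columnMoment j i k).const_mul (c i * c k)]
    exact Finset.sum_congr rfl fun k _ => integral_const_mul _ _
  simp_rw [h1, columnMoment_eq]
  have h2 : ∀ i k, c i * c k * ((if i = k then 2 else 1) / ((d : ℝ) * (d + 1))) =
      (c i * c k + if i = k then c i * c k else 0) / ((d : ℝ) * (d + 1)) := by
    intro i k; split_ifs <;> ring
  simp_rw [h2, ← Finset.sum_div, Finset.sum_add_distrib, Finset.sum_ite_eq, Finset.mem_univ,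
    if_true, sq, Finset.sum_mul_sum]

/-- Together with left invariance of Haar measure, this reduces Hermitian matrices to diagonal ones.
-/
theorem columnForm_conj (B : Matrix (Fin d) (Fin d) ℂ) (j : Fin d)
    (W U : Matrix.unitaryGroup (Fin d) ℂ) :
    columnForm (W.1 * B * star W.1) j U = columnForm B j (star W * U) := by
  simp [columnForm, Matrix.mul_assoc, star_mul]

/-- After diagonalization the centred form is `∑ (cᵢ - c̄)|uᵢ|²`, where `c̄` is the mean of the
eigenvalues, because `∑ |uᵢ|² = 1`. The centred coefficients sum to zero, so only the sum of their
squares survives in `integral_sq_diagonal`, and centring does not increase it. -/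
theorem integral_sq_hermitian {H : Matrix (Fin d) (Fin d) ℂ} (hH : H.IsHermitian) (j : Fin d) :
    ∫ U, ((columnForm H j U).re - H.trace.re / d) ^ 2 ∂(haarUnitary d) ≤
      (∑ i, ∑ k, Complex.normSq (H i k)) / ((d : ℝ) * (d + 1)) := by
  have hd : 0 < (d : ℝ) := by exact_mod_cast Fin.pos j
  set c := hH.eigenvalues with hc
  set W := hH.eigenvectorUnitary with hW
  have hspec : H = W.1 * Matrix.diagonal (fun i => (c i : ℂ)) * star W.1 := by
    conv_lhs => rw [hH.spectral_theorem]
    rfl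
  have htr : H.trace.re = ∑ i, c i := by
    rw [hH.trace_eq_sum_eigenvalues]
    simp [hc]
  have hsq : ∑ i, ∑ k, Complex.normSq (H i k) = ∑ i, c i ^ 2 := by
    have h1 : ((∑ i, ∑ k, Complex.normSq (H i k) : ℝ) : ℂ) = (H * star H).trace := by
      push_cast
      simp only [Matrix.trace, Matrix.diag, Matrix.mul_apply, Matrix.star_apply]
      exact Finset.sum_congr rfl fun i _ => Finset.sum_congr rfl fun k _ =>
        (Complex.mul_conj _).symm
    have h2 : (H * star H).trace = ((∑ i, c i ^ 2 : ℝ) : ℂ) := by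
      have hs : star H = H := hH
      have hWW : star W.1 * W.1 = 1 := Matrix.mem_unitaryGroup_iff'.mp W.2
      rw [hs, hspec]
      have : W.1 * Matrix.diagonal (fun i => (c i : ℂ)) * star W.1 *
          (W.1 * Matrix.diagonal (fun i => (c i : ℂ)) * star W.1) =
          W.1 * (Matrix.diagonal (fun i => (c i : ℂ)) * Matrix.diagonal (fun i => (c i : ℂ)))
            * star W.1 := by
        calc _ = W.1 * Matrix.diagonal (fun i => (c i : ℂ)) * (star W.1 * W.1) *
              Matrix.diagonal (fun i => (c i : ℂ)) * star W.1 := by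
              simp only [Matrix.mul_assoc]
          _ = _ := by rw [hWW, Matrix.mul_one]; simp only [Matrix.mul_assoc]
      rw [this, Matrix.trace_mul_comm, ← Matrix.mul_assoc, hWW, Matrix.one_mul,
        Matrix.diagonal_mul_diagonal, Matrix.trace_diagonal]
      push_cast
      simp only [sq]
    exact_mod_cast h1.trans h2
  have hform : ∀ U, (columnForm H j U).re - H.trace.re / d =
      ∑ i, (c i - (∑ l, c l) / d) * Complex.normSq ((star W * U).1 i j) := by
    intro U
    conv_lhs => rw [htr, hspec, columnForm_conj, columnForm_diagonal, Complex.ofReal_re]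
    simp_rw [sub_mul, Finset.sum_sub_distrib, ← Finset.mul_sum]
    rw [sum_normSq_column, mul_one]
  simp_rw [hform]
  rw [integral_mul_left_eq_self (μ := haarUnitary d) (fun U : Matrix.unitaryGroup (Fin d) ℂ =>
    (∑ i, (c i - (∑ l, c l) / d) * Complex.normSq (U.1 i j)) ^ 2) (star W),
    integral_sq_diagonal, hsq]
  have h0 : ∑ i, (c i - (∑ l, c l) / d) = 0 := by
    rw [Finset.sum_sub_distrib, Finset.sum_const, Finset.card_univ, Fintype.card_fin, nsmul_eq_mul]
    field_simp
    ring
  have h1 : ∑ i, (c i - (∑ l, c l) / d) ^ 2 ≤ ∑ i, c i ^ 2 := by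
    have : ∑ i, (c i - (∑ l, c l) / d) ^ 2 =
        ∑ i, c i ^ 2 - ∑ i, (c i - (∑ l, c l) / d) * (2 * ((∑ l, c l) / d))
          - ∑ i : Fin d, ((∑ l, c l) / d) ^ 2 := by
      rw [← Finset.sum_sub_distrib, ← Finset.sum_sub_distrib]
      exact Finset.sum_congr rfl fun i _ => by ring
    rw [this, ← Finset.sum_mul, h0]
    have : 0 ≤ ∑ i : Fin d, ((∑ l, c l) / d) ^ 2 := Finset.sum_nonneg fun _ _ => sq_nonneg _
    linarith
  rw [h0]
  have : (0 : ℝ) ^ 2 + ∑ i, (c i - (∑ l, c l) / d) ^ 2 ≤ ∑ i, c i ^ 2 := by simpa using h1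
  gcongr

/-- Write `B = H₁ + iH₂` with Hermitian parts. Their forms and traces are real, so the squared
modulus is the sum of two Hermitian deviations, and the Hilbert–Schmidt norms satisfy `‖H₁‖² + ‖H₂‖²
= ‖B‖²`. -/
theorem integral_sq_columnForm (B : Matrix (Fin d) (Fin d) ℂ) (j : Fin d) :
    ∫ U, ‖columnForm B j U - B.trace / d‖ ^ 2 ∂(haarUnitary d) ≤
      (∑ i, ∑ k, Complex.normSq (B i k)) / ((d : ℝ) * (d + 1)) := by
  set H₁ : Matrix (Fin d) (Fin d) ℂ := (1 / 2 : ℂ) • (B + star B) with hH₁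
  set H₂ : Matrix (Fin d) (Fin d) ℂ := (-Complex.I / 2) • (B - star B) with hH₂
  have h₁ : H₁.IsHermitian := by
    change star H₁ = H₁
    rw [hH₁, star_smul, star_add, star_star, add_comm]
    congr 1
    simp
  have h₂ : H₂.IsHermitian := by
    change star H₂ = H₂
    rw [hH₂, star_smul, star_sub, star_star, ← neg_sub B (star B), smul_neg, ← neg_smul]
    congr 1
    simp [neg_div]
  have hB : B = H₁ + Complex.I • H₂ := by
    rw [hH₁, hH₂, smul_smul]
    have : Complex.I * (-Complex.I / 2) = 1 / 2 := by
      linear_combination (-1 / 2) * Complex.I_mul_I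
    rw [this]
    module
  have him : ∀ {H : Matrix (Fin d) (Fin d) ℂ}, H.IsHermitian → ∀ i, (H i i).im = 0 := by
    intro H hH i
    have := congrArg Complex.im (hH.apply i i)
    simp only [Complex.star_def, Complex.conj_im] at this
    linarith
  have hform : ∀ {H : Matrix (Fin d) (Fin d) ℂ}, H.IsHermitian → ∀ U, (columnForm H j U).im = 0 := by
    intro H hH U
    refine him (H := star U.1 * H * U.1) ?_ j
    change star (star U.1 * H * U.1) = _
    have hs : star H = H := hH
    rw [star_mul, star_mul, star_star, hs, Matrix.mul_assoc]
  have htr : ∀ {H : Matrix (Fin d) (Fin d) ℂ}, H.IsHermitian → H.trace.im = 0 := by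
    intro H hH
    rw [Matrix.trace, Complex.im_sum]
    exact Finset.sum_eq_zero fun i _ => him hH i
  have hpt : ∀ U, ‖columnForm B j U - B.trace / d‖ ^ 2 =
      ((columnForm H₁ j U).re - H₁.trace.re / d) ^ 2 +
      ((columnForm H₂ j U).re - H₂.trace.re / d) ^ 2 := by
    intro U
    have e1 : columnForm B j U = columnForm H₁ j U + Complex.I * columnForm H₂ j U := by
      conv_lhs => rw [hB]
      simp [columnForm, mul_add, add_mul]
    have e2 : B.trace = H₁.trace + Complex.I * H₂.trace := by
      conv_lhs => rw [hB]
      simp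
    rw [e1, e2, ← Complex.normSq_eq_norm_sq, Complex.normSq_apply]
    simp [hform h₁, hform h₂, htr h₁, htr h₂, Complex.div_natCast_re, Complex.div_natCast_im]
    ring
  have hint : ∀ H : Matrix (Fin d) (Fin d) ℂ, Integrable
      (fun U => ((columnForm H j U).re - H.trace.re / d) ^ 2) (haarUnitary d) := fun H =>
    integrable_haarUnitary (((Complex.continuous_re.comp (continuous_columnForm H j)).sub
      continuous_const).pow 2)
  simp_rw [hpt]
  rw [integral_add (hint _) (hint _)]
  refine (add_le_add (integral_sq_hermitian h₁ j) (integral_sq_hermitian h₂ j)).trans_eq ?_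
  rw [← add_div]
  congr 1
  have hentry : ∀ i k, Complex.normSq (H₁ i k) + Complex.normSq (H₂ i k) =
      (1 / 2) * Complex.normSq (B i k) + (1 / 2) * Complex.normSq (B k i) := by
    intro i k
    rw [hH₁, hH₂]
    simp [Complex.normSq_apply]
    ring
  simp_rw [← Finset.sum_add_distrib, hentry, Finset.sum_add_distrib, ← Finset.mul_sum]
  rw [Finset.sum_comm (f := fun i k => Complex.normSq (B k i))]
  ring

end QuadraticForm

/-! ### A strong law from Hoeffding's inequality and Borel–Cantelli. -/

section StrongLaw

open ProbabilityTheory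

/-- A strong law for uniformly bounded nonnegative independent variables whose means tend to
zero. -/
theorem ae_tendsto_average_of_bounded {Ω : ℕ → Type*} {mΩ : ∀ i, MeasurableSpace (Ω i)}
    (P : ∀ i, Measure (Ω i)) [∀ i, IsProbabilityMeasure (P i)] (X : ∀ i, Ω i → ℝ)
    (hX : ∀ i, Measurable (X i)) {C : ℝ} (hbound : ∀ i w, X i w ∈ Set.Icc 0 C)
    (hmean : Tendsto (fun i => ∫ w, X i w ∂(P i)) atTop (𝓝 0)) :
    ∀ᵐ w ∂(Measure.infinitePi P), Tendsto
      (fun N : ℕ => (N : ℝ)⁻¹ * ∑ k ∈ Finset.range N, X k (w k)) atTop (𝓝 0) := by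
  set μ := Measure.infinitePi P with hμ
  set m : ℕ → ℝ := fun i => ∫ w, X i w ∂(P i) with hm
  set Y : ∀ i, Ω i → ℝ := fun i w => X i w - m i with hY
  have hmap : ∀ i, ∫ w, X i (w i) ∂μ = m i := by
    intro i
    change _ = ∫ w, X i w ∂(P i)
    conv_rhs => rw [← Measure.infinitePi_map_eval P i]
    exact (integral_map (measurable_pi_apply i).aemeasurable
      (hX i).aestronglyMeasurable).symm
  have hindep : iIndepFun (fun i (w : ∀ i, Ω i) => Y i (w i)) μ :=
    iIndepFun_infinitePi fun i => (hX i).sub_const _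
  set c : NNReal := (‖C - 0‖₊ / 2) ^ 2 with hc
  have hsub : ∀ i, HasSubgaussianMGF (fun w : ∀ i, Ω i => Y i (w i)) c μ := by
    intro i
    have := hasSubgaussianMGF_of_mem_Icc (μ := μ) (X := fun w : ∀ i, Ω i => X i (w i)) (a := 0)
      (b := C) ((hX i).comp (measurable_pi_apply i)).aemeasurable
      (Eventually.of_forall fun w => hbound i (w i))
    rwa [hmap] at this
  -- Only the upper tail is needed, since the averages of `X` are nonnegative. Hoeffding's bound
  -- decays geometrically in `N`, so Borel–Cantelli applies.
  have hdev : ∀ ε : ℝ, 0 < ε → ∀ᵐ w ∂μ, ∀ᶠ N : ℕ in atTop,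
      ∑ k ∈ Finset.range N, Y k (w k) < ε * N := by
    intro ε hε
    have htail : ∀ N : ℕ, μ {w | ε * N ≤ ∑ k ∈ Finset.range N, Y k (w k)} ≤
        ENNReal.ofReal (Real.exp (-(ε ^ 2 / (2 * (c + 1)))) ^ N) := by
      intro N
      rw [← ofReal_measureReal]
      refine ENNReal.ofReal_le_ofReal ?_
      -- The variance proxy is raised from `c` to `c + 1` to keep the denominator positive when `C =
      -- 0`.
      have h := HasSubgaussianMGF.measure_sum_range_ge_le_of_iIndepFun hindep (n := N) (c := c + 1)
        (fun i _ => ?_) (ε := ε * N) (by positivity)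
      · refine h.trans ?_
        rw [← Real.exp_nat_mul]
        refine Real.exp_le_exp.mpr (le_of_eq ?_)
        rcases Nat.eq_zero_or_pos N with rfl | hN
        · simp
        · have : (0 : ℝ) < N := by exact_mod_cast hN
          have hc0 : (0 : ℝ) < c + 1 := by positivity
          push_cast
          field_simp
      · exact ⟨(hsub i).integrable_exp_mul, fun t => ((hsub i).mgf_le t).trans (by
          refine Real.exp_le_exp.mpr ?_
          push_cast
          nlinarith [sq_nonneg t])⟩
    have hsum : ∑' N : ℕ, μ {w | ε * N ≤ ∑ k ∈ Finset.range N, Y k (w k)} ≠ ⊤ := by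
      refine ne_top_of_le_ne_top ?_ (ENNReal.tsum_le_tsum htail)
      rw [← ENNReal.ofReal_tsum_of_nonneg (fun N => by positivity)]
      · exact ENNReal.ofReal_ne_top
      · refine summable_geometric_of_lt_one (Real.exp_pos _).le ?_
        rw [Real.exp_lt_one_iff]
        have : (0 : ℝ) < c + 1 := by positivity
        have : 0 < ε ^ 2 / (2 * ((c : ℝ) + 1)) := by positivity
        linarith
    filter_upwards [ae_eventually_notMem hsum] with w hw
    filter_upwards [hw] with N hN
    simpa using hN
  have hdev' : ∀ᵐ w ∂μ, ∀ r : ℕ, ∀ᶠ N : ℕ in atTop,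
      ∑ k ∈ Finset.range N, Y k (w k) < (1 / ((r : ℝ) + 1)) * N :=
    ae_all_iff.mpr fun r => hdev _ (by positivity)
  have hces : Tendsto (fun N : ℕ => (N : ℝ)⁻¹ * ∑ k ∈ Finset.range N, m k) atTop (𝓝 0) :=
    hmean.cesaro
  filter_upwards [hdev'] with w hw
  rw [Metric.tendsto_atTop']
  intro ε hε
  obtain ⟨r, hr⟩ := exists_nat_one_div_lt (half_pos hε)
  have h1 : ∀ᶠ N : ℕ in atTop, (N : ℝ)⁻¹ * ∑ k ∈ Finset.range N, m k < ε / 2 :=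
    hces.eventually (gt_mem_nhds (half_pos hε))
  obtain ⟨N₀, hN₀⟩ := eventually_atTop.mp ((hw r).and (h1.and (eventually_gt_atTop 0)))
  refine ⟨N₀, fun N hN => ?_⟩
  obtain ⟨ha, hb, hpos⟩ := hN₀ N hN.le
  have hNpos : (0 : ℝ) < N := by exact_mod_cast hpos
  have hnn : 0 ≤ ∑ k ∈ Finset.range N, X k (w k) :=
    Finset.sum_nonneg fun k _ => (hbound k (w k)).1
  rw [dist_zero_right, Real.norm_of_nonneg (by positivity)]
  have hsplit : ∑ k ∈ Finset.range N, X k (w k) =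
      ∑ k ∈ Finset.range N, Y k (w k) + ∑ k ∈ Finset.range N, m k := by
    rw [← Finset.sum_add_distrib]
    exact Finset.sum_congr rfl fun k _ => by simp [hY]
  rw [hsplit, mul_add]
  have h2 : (N : ℝ)⁻¹ * ∑ k ∈ Finset.range N, Y k (w k) < ε / 2 := by
    rw [inv_mul_lt_iff₀ hNpos]
    refine ha.trans ?_
    rw [mul_comm (N : ℝ)]
    exact mul_lt_mul_of_pos_right hr hNpos
  linarith

end StrongLaw

/-! ### Expected quantum variance of a random basis. -/

section Variance

variable {n : ℕ} {M : Type*} [TopologicalSpace M] [ChartedSpace (Euc n) M] [IsManifold (𝓡 n) ∞ M]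
  [MeasurableSpace M] {g : RiemMetric n M} {V : Submodule ℂ (L2 g)} {d : ℕ}

/-- The matrix of the compression of `A` to `V` in an orthonormal basis of `V`. -/
noncomputable def compressionMatrix (e : OrthonormalBasis (Fin d) ℂ V) (A : L2 g →L[ℂ] L2 g) :
    Matrix (Fin d) (Fin d) ℂ :=
  Matrix.of fun i k => inner ℂ (e i : L2 g) (A (e k : L2 g))

theorem coe_rotate (e : OrthonormalBasis (Fin d) ℂ V) (U : Matrix.unitaryGroup (Fin d) ℂ)
    (j : Fin d) : (rotate e U j : L2 g) = ∑ i, U.1 i j • (e i : L2 g) := by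
  simp [rotate]

theorem inner_rotate (e : OrthonormalBasis (Fin d) ℂ V) (A : L2 g →L[ℂ] L2 g)
    (U : Matrix.unitaryGroup (Fin d) ℂ) (j : Fin d) :
    inner ℂ (rotate e U j : L2 g) (A (rotate e U j : L2 g)) =
      columnForm (compressionMatrix e A) j U := by
  rw [coe_rotate, map_sum, sum_inner, columnForm, Matrix.mul_assoc, Matrix.mul_apply]
  refine Finset.sum_congr rfl fun i _ => ?_
  rw [inner_sum, Matrix.mul_apply, Finset.mul_sum]
  refine Finset.sum_congr rfl fun k _ => ?_
  rw [map_smul, inner_smul_left, inner_smul_right, Matrix.star_apply, compressionMatrix,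
    Matrix.of_apply, Complex.star_def]
  ring

theorem trace_compressionMatrix [FiniteDimensional ℂ V] (e : OrthonormalBasis (Fin d) ℂ V)
    (A : L2 g →L[ℂ] L2 g) :
    (compressionMatrix e A).trace = LinearMap.trace ℂ V (compression V A) := by
  rw [LinearMap.trace_eq_sum_inner _ e]
  refine Finset.sum_congr rfl fun i _ => ?_
  simp only [compressionMatrix, Matrix.diag, Matrix.of_apply, compression]
  change _ = inner ℂ (e i) (V.orthogonalProjectionOnto (A (e i : L2 g)))
  rw [Submodule.inner_orthogonalProjectionOnto_eq_of_mem_left]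

/-- Bessel's inequality bounds each column by `‖A eₖ‖² ≤ ‖A‖²`. -/
theorem sum_normSq_compressionMatrix_le (e : OrthonormalBasis (Fin d) ℂ V)
    (A : L2 g →L[ℂ] L2 g) :
    ∑ i, ∑ k, Complex.normSq (compressionMatrix e A i k) ≤ d * ‖A‖ ^ 2 := by
  rw [Finset.sum_comm]
  have h : ∀ k, ∑ i, Complex.normSq (compressionMatrix e A i k) ≤ ‖A‖ ^ 2 := by
    intro k
    have hon : Orthonormal ℂ fun i => (e i : L2 g) :=
      e.orthonormal.comp_linearIsometry V.subtypeₗᵢ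
    have hb := hon.sum_inner_products_le (x := A (e k : L2 g)) (s := Finset.univ)
    simp only [Complex.normSq_eq_norm_sq, compressionMatrix, Matrix.of_apply]
    refine hb.trans ?_
    have h1 : ‖A (e k : L2 g)‖ ≤ ‖A‖ := by
      have := A.le_opNorm (e k : L2 g)
      rwa [hon.1 k, mul_one] at this
    gcongr
  refine (Finset.sum_le_sum fun k _ => h k).trans_eq ?_
  simp

theorem norm_inner_apply_le (ψ : OrthonormalBasis (Fin d) ℂ V) (A : L2 g →L[ℂ] L2 g) (j : Fin d) :
    ‖inner ℂ (ψ j : L2 g) (A (ψ j : L2 g))‖ ≤ ‖A‖ := by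
  have h1 : ‖(ψ j : L2 g)‖ = 1 := ψ.orthonormal.1 j
  have := (norm_inner_le_norm (𝕜 := ℂ) (ψ j : L2 g) (A (ψ j : L2 g))).trans
    (mul_le_mul_of_nonneg_left (A.le_opNorm _) (norm_nonneg _))
  simpa [h1] using this

theorem average_const_le {c : ℝ} (hc : 0 ≤ c) {f : Fin d → ℝ} (hf : ∀ j, f j ≤ c) :
    (d : ℝ)⁻¹ * ∑ j, f j ≤ c := by
  rcases Nat.eq_zero_or_pos d with rfl | hd
  · simpa using hc
  · have hd' : (0 : ℝ) < d := by exact_mod_cast hd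
    rw [inv_mul_le_iff₀ hd']
    exact (Finset.sum_le_sum fun j _ => hf j).trans_eq (by simp)

theorem quantumVariance_nonneg (ψ : OrthonormalBasis (Fin d) ℂ V) (A : L2 g →L[ℂ] L2 g) :
    0 ≤ quantumVariance ψ A := by
  unfold quantumVariance
  positivity

theorem quantumVariance_le (ψ : OrthonormalBasis (Fin d) ℂ V) (A : L2 g →L[ℂ] L2 g) :
    quantumVariance ψ A ≤ (‖A‖ + ‖liouvilleState g A‖) ^ 2 := by
  refine average_const_le (by positivity) fun j => ?_
  have := (norm_sub_le (inner ℂ (ψ j : L2 g) (A (ψ j : L2 g))) (liouvilleState g A)).trans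
    (add_le_add (norm_inner_apply_le ψ A j) le_rfl)
  gcongr

/-- Stability in the operator, uniform in the basis; the inequality is `‖x + y‖² ≤ 2‖x‖² + 2‖y‖²`
termwise. It serves to pass from a dense set of operators to all of them. -/
theorem quantumVariance_le_add (ψ : OrthonormalBasis (Fin d) ℂ V) (A B : L2 g →L[ℂ] L2 g) :
    quantumVariance ψ A ≤ 2 * quantumVariance ψ B +
      2 * (‖A - B‖ + ‖liouvilleState g A - liouvilleState g B‖) ^ 2 := by
  have hpt : ∀ j, ‖inner ℂ (ψ j : L2 g) (A (ψ j : L2 g)) - liouvilleState g A‖ ^ 2 ≤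
      2 * ‖inner ℂ (ψ j : L2 g) (B (ψ j : L2 g)) - liouvilleState g B‖ ^ 2 +
      2 * (‖A - B‖ + ‖liouvilleState g A - liouvilleState g B‖) ^ 2 := by
    intro j
    set x := inner ℂ (ψ j : L2 g) (B (ψ j : L2 g)) - liouvilleState g B
    set y := inner ℂ (ψ j : L2 g) ((A - B) (ψ j : L2 g)) -
      (liouvilleState g A - liouvilleState g B) with hy
    have hxy : inner ℂ (ψ j : L2 g) (A (ψ j : L2 g)) - liouvilleState g A = x + y := by
      rw [hy, sub_apply, inner_sub_right]
      ring
    have hyn : ‖y‖ ≤ ‖A - B‖ + ‖liouvilleState g A - liouvilleState g B‖ :=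
      (norm_sub_le _ _).trans (add_le_add (norm_inner_apply_le ψ (A - B) j) le_rfl)
    rw [hxy]
    have h1 : ‖x + y‖ ^ 2 ≤ (‖x‖ + ‖y‖) ^ 2 := by gcongr; exact norm_add_le _ _
    have h2 : ‖y‖ ^ 2 ≤ (‖A - B‖ + ‖liouvilleState g A - liouvilleState g B‖) ^ 2 := by gcongr
    nlinarith [sq_nonneg (‖x‖ - ‖y‖)]
  rcases Nat.eq_zero_or_pos d with rfl | hd
  · simp only [quantumVariance, Finset.univ_eq_empty, Finset.sum_empty, mul_zero, zero_add]
    positivity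
  · have hd' : (0 : ℝ) < d := by exact_mod_cast hd
    simp only [quantumVariance]
    rw [inv_mul_le_iff₀ hd']
    refine (Finset.sum_le_sum fun j _ => hpt j).trans_eq ?_
    rw [Finset.sum_add_distrib, ← Finset.mul_sum]
    simp
    field_simp

theorem quantumVariance_rotate (e : OrthonormalBasis (Fin d) ℂ V) (A : L2 g →L[ℂ] L2 g)
    (U : Matrix.unitaryGroup (Fin d) ℂ) : quantumVariance (rotate e U) A =
      (d : ℝ)⁻¹ * ∑ j, ‖columnForm (compressionMatrix e A) j U - liouvilleState g A‖ ^ 2 := by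
  simp only [quantumVariance, inner_rotate]

theorem continuous_quantumVariance (e : OrthonormalBasis (Fin d) ℂ V) (A : L2 g →L[ℂ] L2 g) :
    Continuous fun U => quantumVariance (rotate e U) A := by
  simp_rw [quantumVariance_rotate]
  exact continuous_const.mul (continuous_finsetSum _ fun j _ =>
    ((continuous_columnForm _ j).sub continuous_const).norm.pow 2)

/-- The deviation from `ω(A)` splits into the random fluctuation about the normalized trace and the
deterministic error of the Weyl law. -/
theorem integral_quantumVariance_le [FiniteDimensional ℂ V] (e : OrthonormalBasis (Fin d) ℂ V)
    (A : L2 g →L[ℂ] L2 g) :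
    ∫ U, quantumVariance (rotate e U) A ∂(haarUnitary d) ≤ 2 * (‖A‖ ^ 2 / (d + 1)) +
      2 * ‖(d : ℂ)⁻¹ * LinearMap.trace ℂ V (compression V A) - liouvilleState g A‖ ^ 2 := by
  set B := compressionMatrix e A with hB
  set δ := (d : ℂ)⁻¹ * LinearMap.trace ℂ V (compression V A) - liouvilleState g A with hδ
  have hδ' : δ = B.trace / d - liouvilleState g A := by
    rw [hδ, hB, trace_compressionMatrix, div_eq_inv_mul]
  have hint : ∀ (j : Fin d) (z : ℂ),
      Integrable (fun U => ‖columnForm B j U - z‖ ^ 2) (haarUnitary d) := fun j z =>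
    integrable_haarUnitary (((continuous_columnForm B j).sub continuous_const).norm.pow 2)
  simp_rw [quantumVariance_rotate]
  rw [integral_const_mul, integral_finsetSum _ fun j _ => hint j _]
  refine average_const_le (by positivity) fun j => ?_
  have hpt : ∀ U, ‖columnForm B j U - liouvilleState g A‖ ^ 2 ≤
      2 * ‖columnForm B j U - B.trace / d‖ ^ 2 + 2 * ‖δ‖ ^ 2 := by
    intro U
    have : columnForm B j U - liouvilleState g A = (columnForm B j U - B.trace / d) + δ := by
      rw [hδ']; ring
    rw [this]
    have h1 : ‖columnForm B j U - B.trace / d + δ‖ ^ 2 ≤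
      (‖columnForm B j U - B.trace / d‖ + ‖δ‖) ^ 2 := by gcongr; exact norm_add_le _ _
    nlinarith [sq_nonneg (‖columnForm B j U - B.trace / d‖ - ‖δ‖)]
  refine (integral_mono (hint j _) (((hint j _).const_mul 2).add (integrable_const _)) hpt).trans ?_
  rw [integral_add' ((hint j _).const_mul 2) (integrable_const _), integral_const_mul]
  simp only [integral_const, probReal_univ, one_smul]
  have hd : 0 < (d : ℝ) := by exact_mod_cast Fin.pos j
  have h1 := (integral_sq_columnForm B j).trans
    (div_le_div_of_nonneg_right (sum_normSq_compressionMatrix_le e A) (by positivity))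
  rw [mul_div_mul_left _ _ hd.ne'] at h1
  linarith

end Variance

/-! ### Almost sure ergodicity, given separability. -/

section Ergodicity

variable {n : ℕ} {M : Type*} [TopologicalSpace M] [ChartedSpace (Euc n) M] [IsManifold (𝓡 n) ∞ M]
  [MeasurableSpace M] {g : RiemMetric n M} {V : ℕ → Submodule ℂ (L2 g)}
  [∀ N, FiniteDimensional ℂ (V N)]

theorem ae_tendsto_average_quantumVariance
    (hdim : Tendsto (fun N => Module.finrank ℂ (V N)) atTop atTop)
    (hWeyl : LocalWeyl g V)
    (e : ∀ N, OrthonormalBasis (Fin (Module.finrank ℂ (V N))) ℂ (V N))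
    {A : L2 g →L[ℂ] L2 g} (hA : A ∈ Psi0 g) :
    ∀ᵐ U ∂(Measure.infinitePi fun N => haarUnitary (Module.finrank ℂ (V N))),
      Tendsto (fun N : ℕ => (N : ℝ)⁻¹ *
        ∑ k ∈ Finset.range N, quantumVariance (rotate (e k) (U k)) A) atTop (𝓝 0) := by
  refine ae_tendsto_average_of_bounded (fun N => haarUnitary (Module.finrank ℂ (V N)))
    (fun k U => quantumVariance (rotate (e k) U) A)
    (fun k => (continuous_quantumVariance (e k) A).measurable)
    (C := (‖A‖ + ‖liouvilleState g A‖) ^ 2)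
    (fun k U => ⟨quantumVariance_nonneg _ _, quantumVariance_le _ _⟩) ?_
  refine squeeze_zero (fun k => integral_nonneg fun U => quantumVariance_nonneg _ _)
    (fun k => integral_quantumVariance_le (e k) A) ?_
  have h1 : Tendsto (fun N => ‖A‖ ^ 2 / ((Module.finrank ℂ (V N) : ℝ) + 1)) atTop (𝓝 0) :=
    tendsto_const_nhds.div_atTop
      (tendsto_atTop_add_const_right _ _ (tendsto_natCast_atTop_atTop.comp hdim))
  have h2 := ((hWeyl A hA).sub_const (liouvilleState g A)).norm.pow 2
  simpa using (h1.const_mul 2).add (h2.const_mul 2)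

theorem norm_trace_compression_le (W : Submodule ℂ (L2 g)) [FiniteDimensional ℂ W]
    (A : L2 g →L[ℂ] L2 g) :
    ‖(Module.finrank ℂ W : ℂ)⁻¹ * LinearMap.trace ℂ W (compression W A)‖ ≤ ‖A‖ := by
  set e := stdOrthonormalBasis ℂ W
  rw [← trace_compressionMatrix e, Matrix.trace, norm_mul, norm_inv, Complex.norm_natCast]
  refine (mul_le_mul_of_nonneg_left (norm_sum_le _ _) (by positivity)).trans ?_
  exact average_const_le (norm_nonneg _) fun j => norm_inner_apply_le e A j

/-- Both values are limits of normalized traces, which are linear and contractive in operator norm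
at each level. Hence no linearity of the principal symbol, nor membership of `A - B` in `Ψ⁰(M)`, is
required. -/
theorem norm_liouvilleState_sub_le (hWeyl : LocalWeyl g V) {A B : L2 g →L[ℂ] L2 g}
    (hA : A ∈ Psi0 g) (hB : B ∈ Psi0 g) :
    ‖liouvilleState g A - liouvilleState g B‖ ≤ ‖A - B‖ := by
  refine le_of_tendsto ((hWeyl A hA).sub (hWeyl B hB)).norm (Eventually.of_forall fun N => ?_)
  have : (Module.finrank ℂ (V N) : ℂ)⁻¹ * LinearMap.trace ℂ (V N) (compression (V N) A) -
      (Module.finrank ℂ (V N) : ℂ)⁻¹ * LinearMap.trace ℂ (V N) (compression (V N) B) =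
      (Module.finrank ℂ (V N) : ℂ)⁻¹ * LinearMap.trace ℂ (V N) (compression (V N) (A - B)) := by
    rw [← mul_sub, ← map_sub]
    congr 2
    ext x
    simp [compression]
  rw [this]
  exact norm_trace_compression_le _ _

/-- Almost sure quantum ergodicity, once `Ψ⁰(M)` is known to be separable in operator norm. -/
theorem ae_isQuantumErgodic_of_isSeparable
    (hdim : Tendsto (fun N => Module.finrank ℂ (V N)) atTop atTop)
    (hWeyl : LocalWeyl g V)
    (e : ∀ N, OrthonormalBasis (Fin (Module.finrank ℂ (V N))) ℂ (V N))
    (hsep : TopologicalSpace.IsSeparable (Psi0 g)) :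
    ∀ᵐ U ∂(Measure.infinitePi fun N => haarUnitary (Module.finrank ℂ (V N))),
      IsQuantumErgodic (fun N => rotate (e N) (U N)) := by
  obtain ⟨D, hDsub, hDc, hD⟩ := hsep.exists_countable_dense_subset
  have hae : ∀ᵐ U ∂(Measure.infinitePi fun N => haarUnitary (Module.finrank ℂ (V N))),
      ∀ B ∈ D, Tendsto (fun N : ℕ => (N : ℝ)⁻¹ *
        ∑ k ∈ Finset.range N, quantumVariance (rotate (e k) (U k)) B) atTop (𝓝 0) :=
    (ae_ball_iff hDc).mpr fun B hB => ae_tendsto_average_quantumVariance hdim hWeyl e (hDsub hB)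
  filter_upwards [hae] with U hU
  intro A hA
  rw [Metric.tendsto_atTop]
  intro ε hε
  -- `2δ` will bound `‖A - B‖ + |ω(A) - ω(B)|`. For `δ ≤ 1` one has `8δ² ≤ 8δ ≤ ε / 4`.
  obtain ⟨δ, hδ, hδε⟩ : ∃ δ > 0, 2 * (2 * δ) ^ 2 < ε / 2 := by
    refine ⟨min 1 (ε / 32), by positivity, ?_⟩
    have h1 : min 1 (ε / 32) ≤ 1 := min_le_left _ _
    have h2 : min 1 (ε / 32) ≤ ε / 32 := min_le_right _ _
    have h3 : 0 < min 1 (ε / 32) := by positivity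
    nlinarith
  obtain ⟨B, hBD, hAB⟩ := Metric.mem_closure_iff.mp (hD hA) δ hδ
  rw [dist_eq_norm] at hAB
  obtain ⟨N₀, hN₀⟩ := Metric.tendsto_atTop.mp (hU B hBD) (ε / 4) (by positivity)
  refine ⟨N₀, fun N hN => ?_⟩
  have h1 := hN₀ N hN
  rw [dist_zero_right] at h1 ⊢
  have hnn : ∀ A', 0 ≤ (N : ℝ)⁻¹ * ∑ k ∈ Finset.range N, quantumVariance (rotate (e k) (U k)) A' :=
    fun A' => mul_nonneg (by positivity) (Finset.sum_nonneg fun k _ => quantumVariance_nonneg _ _)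
  rw [Real.norm_of_nonneg (hnn _)] at h1 ⊢
  have hle : ∀ k, quantumVariance (rotate (e k) (U k)) A ≤
      2 * quantumVariance (rotate (e k) (U k)) B + 2 * (2 * δ) ^ 2 := by
    intro k
    refine (quantumVariance_le_add _ A B).trans ?_
    have := norm_liouvilleState_sub_le hWeyl hA (hDsub hBD)
    gcongr
    linarith
  have hsum : (N : ℝ)⁻¹ * ∑ k ∈ Finset.range N, quantumVariance (rotate (e k) (U k)) A ≤
      2 * ((N : ℝ)⁻¹ * ∑ k ∈ Finset.range N, quantumVariance (rotate (e k) (U k)) B) +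
        2 * (2 * δ) ^ 2 := by
    refine (mul_le_mul_of_nonneg_left (Finset.sum_le_sum fun k _ => hle k) (by positivity)).trans ?_
    rw [Finset.sum_add_distrib, ← Finset.mul_sum, Finset.sum_const, Finset.card_range,
      nsmul_eq_mul, mul_add, ← mul_assoc _ (N : ℝ)]
    have : (N : ℝ)⁻¹ * N ≤ 1 := inv_mul_le_one
    have h5 : (N : ℝ)⁻¹ * N * (2 * (2 * δ) ^ 2) ≤ 1 * (2 * (2 * δ) ^ 2) := by gcongr
    linarith
  linarith

end Ergodicity

/-! ### `L²` bound for quantizations of symbols with compact support in `x`. -/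

section OperatorBound

variable {n : ℕ}

theorem integral_norm_le_of_tsupport_subset {E : Type*} [NormedAddCommGroup E] {K : Set (Euc n)}
    (hK : IsCompact K) {f : Euc n → E} (hsupp : tsupport f ⊆ K) {η : ℝ}
    (hη : ∀ x, ‖f x‖ ≤ η) : ∫ x, ‖f x‖ ≤ η * volume.real K := by
  have h1 : ∫ x, ‖f x‖ = ∫ x in K, ‖f x‖ := by
    refine (setIntegral_eq_integral_of_forall_compl_eq_zero fun x hx => ?_).symm
    rw [image_eq_zero_of_notMem_tsupport fun h => hx (hsupp h), norm_zero]
  rw [h1]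
  have h2 := norm_setIntegral_le_of_norm_le_const (μ := volume) (f := fun x => ‖f x‖) (C := η)
    hK.measure_lt_top (fun x _ => by rw [norm_norm]; exact hη x)
  exact (Real.le_norm_self _).trans h2

/-- Integration by parts `m` times bounds `‖w‖ ^ m ‖𝓕 f w‖`; the cases `m = 0` and `m = n + 1` are
combined. The exponent `n + 1` is the least integer for which the bound is integrable on `ℝⁿ`. -/
theorem exists_fourier_decay {K : Set (Euc n)} (hK : IsCompact K) :
    ∃ C : ℝ, 0 ≤ C ∧ ∀ (f : Euc n → ℂ) (η : ℝ), ContDiff ℝ ∞ f → tsupport f ⊆ K →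
      (∀ k ≤ n + 1, ∀ x, ‖iteratedFDeriv ℝ k f x‖ ≤ η) →
      ∀ w, ‖𝓕 f w‖ ≤ C * η * ((1 + ‖w‖) ^ (n + 1))⁻¹ := by
  refine ⟨2 ^ n * (1 + 2 ^ (n + 1) * (n + 2)) * volume.real K, by positivity,
    fun f η hf hsupp hη w => ?_⟩
  have hη0 : 0 ≤ η := (norm_nonneg _).trans (hη 0 (Nat.zero_le _) 0)
  have hcomp : HasCompactSupport f := hK.of_isClosed_subset (isClosed_tsupport f) hsupp
  have hderiv : ∀ k, Continuous (iteratedFDeriv ℝ k f) := fun k =>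
    hf.continuous_iteratedFDeriv (by exact_mod_cast le_top)
  have hts : ∀ k, tsupport (iteratedFDeriv ℝ k f) ⊆ K := fun k =>
    (tsupport_iteratedFDeriv_subset k).trans hsupp
  have hint : ∀ k m : ℕ, Integrable fun v : Euc n => ‖v‖ ^ k * ‖iteratedFDeriv ℝ m f v‖ := by
    intro k m
    have hc : HasCompactSupport (iteratedFDeriv ℝ m f) :=
      hK.of_isClosed_subset (isClosed_tsupport _) (hts m)
    exact ((continuous_norm.pow k).mul (hderiv m).norm).integrable_of_hasCompactSupport
      hc.norm.mul_left
  have key : ∀ m ≤ n + 1, ‖w‖ ^ m * ‖𝓕 f w‖ ≤ 2 ^ m * ((m + 1) * (η * volume.real K)) := by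
    intro m hm
    have h := Real.pow_mul_norm_iteratedFDeriv_fourier_le (K := ⊤) (N := ⊤) (k := 0) (n := m)
      (f := f) hf (fun k m _ _ => hint k m) (by simp) (by simp) w
    rw [norm_iteratedFDeriv_zero] at h
    refine h.trans ?_
    simp only [pow_zero, Nat.cast_zero, mul_zero, zero_add, one_mul]
    refine mul_le_mul_of_nonneg_left ?_ (by positivity)
    have hle : ∀ p ∈ Finset.range 1 ×ˢ Finset.range (m + 1),
        ∫ v, ‖v‖ ^ p.1 * ‖iteratedFDeriv ℝ p.2 f v‖ ≤ η * volume.real K := by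
      intro p hp
      obtain ⟨hp1, hp2⟩ := Finset.mem_product.mp hp
      have e1 : p.1 = 0 := by simpa using hp1
      have e2 : p.2 ≤ n + 1 := by have := Finset.mem_range.mp hp2; omega
      simp only [e1, pow_zero, one_mul]
      exact integral_norm_le_of_tsupport_subset hK (hts _) (hη _ e2)
    refine (Finset.sum_le_card_nsmul _ _ _ hle).trans_eq ?_
    simp
  have h0 := key 0 (Nat.zero_le _)
  have h1 := key (n + 1) le_rfl
  have hpow : (1 + ‖w‖) ^ (n + 1) ≤ 2 ^ n * (1 ^ (n + 1) + ‖w‖ ^ (n + 1)) := by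
    simpa using add_pow_le (zero_le_one) (norm_nonneg w) (n + 1)
  rw [← div_eq_mul_inv, le_div_iff₀ (by positivity), mul_comm]
  calc (1 + ‖w‖) ^ (n + 1) * ‖𝓕 f w‖ ≤ 2 ^ n * (1 ^ (n + 1) + ‖w‖ ^ (n + 1)) * ‖𝓕 f w‖ := by
        gcongr
    _ = 2 ^ n * (‖w‖ ^ 0 * ‖𝓕 f w‖ + ‖w‖ ^ (n + 1) * ‖𝓕 f w‖) := by ring
    _ ≤ 2 ^ n * (2 ^ 0 * (((0 : ℕ) + 1) * (η * volume.real K)) +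
        2 ^ (n + 1) * (((n + 1 : ℕ) + 1) * (η * volume.real K))) := by gcongr
    _ = _ := by push_cast; ring

theorem norm_exp_inner (x ξ : Euc n) :
    ‖Complex.exp (2 * Real.pi * Complex.I * (inner ℝ x ξ : ℝ))‖ = 1 := by
  have : (2 * Real.pi * Complex.I * (inner ℝ x ξ : ℝ) : ℂ) =
    ((2 * Real.pi * inner ℝ x ξ : ℝ) : ℂ) * Complex.I := by push_cast; ring
  rw [this, Complex.norm_exp_ofReal_mul_I]

theorem fourier_exp_mul (f : Euc n → ℂ) (ξ w : Euc n) :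
    𝓕 (fun x => Complex.exp (2 * Real.pi * Complex.I * (inner ℝ x ξ : ℝ)) * f x) w =
      𝓕 f (w - ξ) := by
  rw [Real.fourier_eq', Real.fourier_eq']
  congr 1
  funext x
  rw [smul_eq_mul, smul_eq_mul, ← mul_assoc, ← Complex.exp_add]
  congr 2
  rw [inner_sub_right]
  push_cast
  ring

/-- The pairing of `e^{2πi⟨·,ξ⟩} f` with a Schwartz function, on the Fourier side. -/
theorem integral_star_mul_exp_mul {f : Euc n → ℂ} (hf : ContDiff ℝ ∞ f)
    (hc : HasCompactSupport f) (v : 𝓢(Euc n, ℂ)) (ξ : Euc n) :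
    ∫ x, star (v x) * (Complex.exp (2 * Real.pi * Complex.I * (inner ℝ x ξ : ℝ)) * f x) =
      ∫ w, star ((𝓕 v : 𝓢(Euc n, ℂ)) (ξ + w)) * 𝓕 f w := by
  set h : Euc n → ℂ := fun x => Complex.exp (2 * Real.pi * Complex.I * (inner ℝ x ξ : ℝ)) * f x
    with hh
  have hsm : ContDiff ℝ ∞ h := by
    refine ContDiff.mul ?_ hf
    refine Complex.contDiff_exp.comp ?_
    refine contDiff_const.mul ?_
    exact Complex.ofRealCLM.contDiff.comp (contDiff_id.inner ℝ contDiff_const)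
  have hcs : HasCompactSupport h := hc.mul_left
  have hP := SchwartzMap.integral_inner_fourier_fourier v (hcs.toSchwartzMap hsm)
  simp only [RCLike.inner_apply] at hP
  have e1 : ∫ x, star (v x) * h x = ∫ x, h x * (starRingEnd ℂ) (v x) := by
    congr 1; funext x; rw [mul_comm]; rfl
  have e2 : ∀ w, (𝓕 (hcs.toSchwartzMap hsm) : 𝓢(Euc n, ℂ)) w = 𝓕 f (w - ξ) := by
    intro w
    rw [SchwartzMap.fourier_coe]
    exact fourier_exp_mul f ξ w
  rw [e1]
  refine Eq.trans hP.symm ?_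
  simp_rw [e2]
  rw [← integral_add_left_eq_self _ ξ]
  congr 1
  funext w
  rw [add_sub_cancel_left, mul_comm]
  rfl

/-- Cauchy–Schwarz and translation invariance; the point is that the bound does not depend on `w`.
-/
theorem lintegral_mul_translate_le (f g : Euc n → ℂ) (hf : AEMeasurable f) (hg : Measurable g)
    (w : Euc n) : ∫⁻ ξ, ‖f ξ‖ₑ * ‖g (ξ + w)‖ₑ ≤ eLpNorm f 2 volume * eLpNorm g 2 volume := by
  have h := ENNReal.lintegral_mul_le_Lp_mul_Lq (μ := (volume : Measure (Euc n)))
    Real.HolderConjugate.two_two hf.enorm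
    (hg.comp (measurable_add_const w)).aemeasurable.enorm
  refine h.trans_eq ?_
  rw [eLpNorm_eq_lintegral_rpow_enorm_toReal (by simp) (by simp),
    eLpNorm_eq_lintegral_rpow_enorm_toReal (by simp) (by simp)]
  simp only [ENNReal.toReal_ofNat, Function.comp_apply]
  rw [lintegral_add_right_eq_self (fun ξ => ‖g ξ‖ₑ ^ (2 : ℝ)) w]

theorem eLpNorm_fourier_schwartz (u : 𝓢(Euc n, ℂ)) :
    eLpNorm (𝓕 u : 𝓢(Euc n, ℂ)) 2 volume = eLpNorm u 2 volume := by
  have h := SchwartzMap.norm_fourier_toL2_eq u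
  rw [SchwartzMap.norm_toLp, SchwartzMap.norm_toLp] at h
  exact (ENNReal.toReal_eq_toReal_iff' ((𝓕 u : 𝓢(Euc n, ℂ)).memLp 2 volume).eLpNorm_ne_top
    (u.memLp 2 volume).eLpNorm_ne_top).mp h

theorem lintegral_japanese_lt_top :
    ∫⁻ w : Euc n, ENNReal.ofReal (((1 + ‖w‖) ^ (n + 1))⁻¹) < ⊤ := by
  have h := (integrable_one_add_norm (E := Euc n) (μ := volume) (r := (n + 1 : ℕ))
    (by simp)).lintegral_lt_top
  refine lt_of_eq_of_lt ?_ h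
  refine lintegral_congr fun w => ?_
  rw [Real.rpow_neg (by positivity), Real.rpow_natCast]

/-- The integrand of `Op b u`. -/
noncomputable def opKernel (b : Euc n → Euc n → ℂ) (u : 𝓢(Euc n, ℂ)) (x ξ : Euc n) : ℂ :=
  Complex.exp (2 * Real.pi * Complex.I * (inner ℝ x ξ : ℝ)) *
    b x ((2 * Real.pi) • ξ) * (𝓕 u : 𝓢(Euc n, ℂ)) ξ

theorem Op_eq_integral_opKernel (b : Euc n → Euc n → ℂ) (u : 𝓢(Euc n, ℂ)) (x : Euc n) :
    Op b u x = ∫ ξ, opKernel b u x ξ := rfl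

theorem continuous_opKernel {b : Euc n → Euc n → ℂ}
    (hb : Continuous fun z : Euc n × Euc n => b z.1 z.2) (u : 𝓢(Euc n, ℂ)) :
    Continuous fun z : Euc n × Euc n => opKernel b u z.1 z.2 := by
  refine (Continuous.mul ?_ ?_).mul ?_
  · exact Complex.continuous_exp.comp (continuous_const.mul
      (Complex.continuous_ofReal.comp (continuous_fst.inner continuous_snd)))
  · exact hb.comp (continuous_fst.prodMk (continuous_snd.const_smul (2 * Real.pi)))
  · exact (𝓕 u : 𝓢(Euc n, ℂ)).continuous.comp continuous_snd

theorem norm_opKernel_le {b : Euc n → Euc n → ℂ} {η : ℝ} (hη : ∀ x ξ, ‖b x ξ‖ ≤ η)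
    (u : 𝓢(Euc n, ℂ)) (x ξ : Euc n) :
    ‖opKernel b u x ξ‖ ≤ η * ‖(𝓕 u : 𝓢(Euc n, ℂ)) ξ‖ := by
  rw [opKernel, norm_mul, norm_mul, norm_exp_inner, one_mul]
  exact mul_le_mul_of_nonneg_right (hη _ _) (norm_nonneg _)

theorem integrable_opKernel {b : Euc n → Euc n → ℂ}
    (hb : Continuous fun z : Euc n × Euc n => b z.1 z.2) {η : ℝ} (hη : ∀ x ξ, ‖b x ξ‖ ≤ η)
    (u : 𝓢(Euc n, ℂ)) (x : Euc n) : Integrable (opKernel b u x) := by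
  refine ((𝓕 u : 𝓢(Euc n, ℂ)).integrable.norm.const_mul η).mono'
    ((continuous_opKernel hb u).comp (Continuous.prodMk_right x)).aestronglyMeasurable
    (Eventually.of_forall fun ξ => norm_opKernel_le hη u x ξ)

theorem norm_Op_le {b : Euc n → Euc n → ℂ} {η : ℝ} (hη : ∀ x ξ, ‖b x ξ‖ ≤ η)
    (u : 𝓢(Euc n, ℂ)) (x : Euc n) : ‖Op b u x‖ ≤ η * ∫ ξ, ‖(𝓕 u : 𝓢(Euc n, ℂ)) ξ‖ := by
  rw [Op_eq_integral_opKernel, ← integral_const_mul]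
  exact norm_integral_le_of_norm_le ((𝓕 u : 𝓢(Euc n, ℂ)).integrable.norm.const_mul η)
    (Eventually.of_forall fun ξ => norm_opKernel_le hη u x ξ)

theorem aestronglyMeasurable_Op {b : Euc n → Euc n → ℂ}
    (hb : Continuous fun z : Euc n × Euc n => b z.1 z.2) (u : 𝓢(Euc n, ℂ)) :
    AEStronglyMeasurable (Op b u) volume :=
  ((continuous_opKernel hb u).stronglyMeasurable.integral_prod_right').aestronglyMeasurable

/-- A crude bound, by boundedness and compact support, not uniform in `‖u‖₂`. It makes `Op b u` an
element of `L²`, as the duality argument below requires. -/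
theorem memLp_Op {b : Euc n → Euc n → ℂ}
    (hb : Continuous fun z : Euc n × Euc n => b z.1 z.2) {η : ℝ} (hη : ∀ x ξ, ‖b x ξ‖ ≤ η)
    {K : Set (Euc n)} (hK : IsCompact K) (hsupp : ∀ ξ, tsupport (fun x => b x ξ) ⊆ K)
    (u : 𝓢(Euc n, ℂ)) : MemLp (Op b u) 2 volume := by
  have h0 : ∀ x ∉ K, Op b u x = 0 := by
    intro x hx
    have : ∀ ξ, opKernel b u x ξ = 0 := by
      intro ξ
      have hz : b x ((2 * Real.pi) • ξ) = 0 :=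
        image_eq_zero_of_notMem_tsupport (f := fun y => b y ((2 * Real.pi) • ξ))
          fun h => hx (hsupp _ h)
      rw [opKernel, hz, mul_zero, zero_mul]
    rw [Op_eq_integral_opKernel]
    simp [this]
  have hind : Op b u = K.indicator (Op b u) := by
    funext x
    by_cases hx : x ∈ K
    · rw [Set.indicator_of_mem hx]
    · rw [Set.indicator_of_notMem hx, h0 x hx]
  rw [hind, memLp_indicator_iff_restrict hK.measurableSet]
  have : IsFiniteMeasure (volume.restrict K) := ⟨by simpa using hK.measure_lt_top⟩
  exact MemLp.of_bound (aestronglyMeasurable_Op hb u).restrict _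
    (Eventually.of_forall fun x => norm_Op_le hη u x)

/-- By Fubini and Parseval, the pairing is the integral of `û(ξ) · conj v̂(ξ + w) · b̂(w, ξ)`, where
`b̂` is the Fourier transform of the symbol in `x`. It decays in `w` uniformly in `ξ`, so
Cauchy–Schwarz in `ξ` for fixed `w`, followed by integration in `w`, gives the bound. No derivative
in `ξ` is used. -/
theorem exists_enorm_pairing_le {K : Set (Euc n)} (hK : IsCompact K) :
    ∃ C : ℝ, 0 ≤ C ∧ ∀ (b : Euc n → Euc n → ℂ) (η : ℝ),
      (Continuous fun z : Euc n × Euc n => b z.1 z.2) →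
      (∀ ξ, ContDiff ℝ ∞ fun x => b x ξ) → (∀ ξ, tsupport (fun x => b x ξ) ⊆ K) →
      (∀ k ≤ n + 1, ∀ x ξ, ‖iteratedFDeriv ℝ k (fun y => b y ξ) x‖ ≤ η) →
      ∀ u v : 𝓢(Euc n, ℂ), ‖∫ x, star (v x) * Op b u x‖ₑ ≤
        ENNReal.ofReal (C * η) * (eLpNorm u 2 volume * eLpNorm v 2 volume) := by
  obtain ⟨C₁, hC₁, hdecay⟩ := exists_fourier_decay hK
  set J := ∫⁻ w : Euc n, ENNReal.ofReal (((1 + ‖w‖) ^ (n + 1))⁻¹) with hJ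
  have hJtop : J ≠ ⊤ := lintegral_japanese_lt_top.ne
  refine ⟨C₁ * J.toReal, by positivity, fun b η hb hsm hsupp hη u v => ?_⟩
  have hη0 : 0 ≤ η := (norm_nonneg _).trans (hη 0 (Nat.zero_le _) 0 0)
  have hbη : ∀ x ξ, ‖b x ξ‖ ≤ η := fun x ξ => by
    simpa using hη 0 (Nat.zero_le _) x ξ
  set Fu : 𝓢(Euc n, ℂ) := 𝓕 u with hFu
  set Fv : 𝓢(Euc n, ℂ) := 𝓕 v with hFv
  have hprod : Integrable (fun z : Euc n × Euc n => star (v z.1) * opKernel b u z.1 z.2)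
      ((volume : Measure (Euc n)).prod volume) := by
    refine Integrable.mono' (g := fun z => η * (‖v z.1‖ * ‖Fu z.2‖))
      ((v.integrable.norm.mul_prod Fu.integrable.norm).const_mul η) ?_ ?_
    · exact ((v.continuous.comp continuous_fst).star.mul
        (continuous_opKernel hb u)).aestronglyMeasurable
    · refine Eventually.of_forall fun z => ?_
      rw [norm_mul, norm_star]
      calc ‖v z.1‖ * ‖opKernel b u z.1 z.2‖ ≤ ‖v z.1‖ * (η * ‖Fu z.2‖) := by
            gcongr
            exact norm_opKernel_le hbη u _ _
        _ = _ := by ring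
  have hswap : ∫ x, star (v x) * Op b u x = ∫ ξ, Fu ξ * ∫ w, star (Fv (ξ + w)) *
      𝓕 (fun x => b x ((2 * Real.pi) • ξ)) w := by
    simp_rw [Op_eq_integral_opKernel, ← integral_const_mul]
    rw [integral_integral_swap (f := fun x ξ => star (v x) * opKernel b u x ξ) hprod]
    congr 1
    funext ξ
    rw [integral_const_mul, ← integral_star_mul_exp_mul (hsm _)
      (hK.of_isClosed_subset (isClosed_tsupport _) (hsupp _)), ← integral_const_mul]
    congr 1
    funext x
    simp only [opKernel]
    ring
  have hin : ∀ ξ, ‖Fu ξ * ∫ w, star (Fv (ξ + w)) * 𝓕 (fun x => b x ((2 * Real.pi) • ξ)) w‖ₑ ≤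
      ∫⁻ w, ENNReal.ofReal (C₁ * η * ((1 + ‖w‖) ^ (n + 1))⁻¹) * (‖Fu ξ‖ₑ * ‖Fv (ξ + w)‖ₑ) := by
    intro ξ
    rw [enorm_mul]
    refine (mul_le_mul_right (enorm_integral_le_lintegral_enorm _) _).trans ?_
    rw [← lintegral_const_mul' _ _ enorm_ne_top]
    refine lintegral_mono fun w => ?_
    rw [enorm_mul]
    have h1 : ‖𝓕 (fun x => b x ((2 * Real.pi) • ξ)) w‖ₑ ≤
        ENNReal.ofReal (C₁ * η * ((1 + ‖w‖) ^ (n + 1))⁻¹) := by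
      rw [← ofReal_norm]
      exact ENNReal.ofReal_le_ofReal (hdecay _ η (hsm _) (hsupp _) (fun k hk x => hη k hk x _) w)
    have h2 : ‖star (Fv (ξ + w))‖ₑ = ‖Fv (ξ + w)‖ₑ := by
      rw [← ofReal_norm, norm_star, ofReal_norm]
    rw [h2, mul_comm (ENNReal.ofReal _), ← mul_assoc]
    gcongr
  have hmeas : Measurable fun w : Euc n =>
      ENNReal.ofReal (C₁ * η * ((1 + ‖w‖) ^ (n + 1))⁻¹) := by fun_prop
  rw [hswap]
  refine (enorm_integral_le_lintegral_enorm _).trans ((lintegral_mono hin).trans ?_)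
  rw [lintegral_lintegral_swap]
  · calc ∫⁻ w, ∫⁻ ξ, ENNReal.ofReal (C₁ * η * ((1 + ‖w‖) ^ (n + 1))⁻¹) *
          (‖Fu ξ‖ₑ * ‖Fv (ξ + w)‖ₑ)
        ≤ ∫⁻ w, ENNReal.ofReal (C₁ * η * ((1 + ‖w‖) ^ (n + 1))⁻¹) *
          (eLpNorm u 2 volume * eLpNorm v 2 volume) := by
          refine lintegral_mono fun w => ?_
          rw [lintegral_const_mul' _ _ ENNReal.ofReal_ne_top]
          gcongr
          refine (lintegral_mul_translate_le Fu Fv Fu.continuous.aemeasurable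
            Fv.continuous.measurable w).trans_eq ?_
          rw [hFu, hFv, eLpNorm_fourier_schwartz, eLpNorm_fourier_schwartz]
      _ = _ := by
          rw [lintegral_mul_const _ hmeas]
          congr 1
          simp_rw [ENNReal.ofReal_mul (mul_nonneg hC₁ hη0)]
          rw [lintegral_const_mul' _ _ ENNReal.ofReal_ne_top, ← hJ, mul_right_comm,
            ENNReal.ofReal_mul (mul_nonneg hC₁ hη0), ENNReal.ofReal_toReal hJtop]
  · refine Measurable.aemeasurable ?_
    refine (hmeas.comp measurable_snd).mul ?_
    exact ((Fu.continuous.comp continuous_fst).enorm.measurable).mul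
      ((Fv.continuous.comp (continuous_fst.add continuous_snd)).enorm.measurable)

/-- The `L²` bound for the quantization of a symbol with compact support in `x`, in terms of
finitely many of its `x`-derivatives. -/
theorem exists_eLpNorm_Op_le {K : Set (Euc n)} (hK : IsCompact K) :
    ∃ C : ℝ, 0 ≤ C ∧ ∀ (b : Euc n → Euc n → ℂ) (η : ℝ),
      (Continuous fun z : Euc n × Euc n => b z.1 z.2) →
      (∀ ξ, ContDiff ℝ ∞ fun x => b x ξ) → (∀ ξ, tsupport (fun x => b x ξ) ⊆ K) →
      (∀ k ≤ n + 1, ∀ x ξ, ‖iteratedFDeriv ℝ k (fun y => b y ξ) x‖ ≤ η) →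
      ∀ u : 𝓢(Euc n, ℂ), eLpNorm (Op b u) 2 volume ≤
        ENNReal.ofReal (C * η) * eLpNorm u 2 volume := by
  obtain ⟨C, hC, hpair⟩ := exists_enorm_pairing_le hK
  refine ⟨C, hC, fun b η hb hsm hsupp hη u => ?_⟩
  have hη0 : 0 ≤ η := (norm_nonneg _).trans (hη 0 (Nat.zero_le _) 0 0)
  have hbη : ∀ x ξ, ‖b x ξ‖ ≤ η := fun x ξ => by
    simpa using hη 0 (Nat.zero_le _) x ξ
  have hmem := memLp_Op hb hbη hK hsupp u
  have hu := (u.memLp 2 volume).eLpNorm_ne_top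
  set F : Lp ℂ 2 (volume : Measure (Euc n)) := hmem.toLp _ with hF
  set c : ℝ := C * η * (eLpNorm u 2 volume).toReal with hc
  have hsch : ∀ v : 𝓢(Euc n, ℂ), ‖inner ℂ (v.toLp 2 volume) F‖ ≤ c * ‖v.toLp 2 volume‖ := by
    intro v
    have e : inner ℂ (v.toLp 2 volume) F = ∫ x, star (v x) * Op b u x := by
      rw [L2.inner_def]
      refine integral_congr_ae ?_
      filter_upwards [v.coeFn_toLp 2 volume, hmem.coeFn_toLp] with x h1 h2
      rw [h1, h2, RCLike.inner_apply, mul_comm]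
      rfl
    have h := hpair b η hb hsm hsupp hη u v
    rw [← e, ← ofReal_norm] at h
    have hv := (v.memLp 2 volume).eLpNorm_ne_top
    have h' := ENNReal.toReal_mono (by finiteness) h
    rw [ENNReal.toReal_ofReal (norm_nonneg _), ENNReal.toReal_mul, ENNReal.toReal_mul,
      ENNReal.toReal_ofReal (mul_nonneg hC hη0)] at h'
    rw [SchwartzMap.norm_toLp, hc, mul_assoc]
    exact h'
  -- Schwartz functions are dense in `L²`, so the pairing bound extends to every `f`; then `f = F`
  -- gives the norm of `F`.
  have hall : ∀ f : Lp ℂ 2 (volume : Measure (Euc n)), ‖inner ℂ f F‖ ≤ c * ‖f‖ := by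
    intro f
    refine (SchwartzMap.denseRange_toLpCLM (F := ℂ) (p := 2) (μ := (volume : Measure (Euc n)))
      ENNReal.ofNat_ne_top).induction_on f ?_ hsch
    exact isClosed_le (continuous_id.inner continuous_const).norm
      (continuous_const.mul continuous_norm)
  have hFn : ‖F‖ ≤ c := by
    have h := hall F
    rw [inner_self_eq_norm_sq_to_K, norm_pow, RCLike.norm_ofReal, abs_norm] at h
    by_contra hlt
    push Not at hlt
    have : 0 ≤ c := by positivity
    nlinarith
  rw [hF, Lp.norm_toLp] at hFn
  have := (ENNReal.le_ofReal_iff_toReal_le hmem.eLpNorm_ne_top (by positivity)).mpr hFn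
  rwa [hc, ENNReal.ofReal_mul (mul_nonneg hC hη0), ENNReal.ofReal_toReal hu] at this

end OperatorBound

/-! ### Regularity and positivity of the Riemannian density. -/

section RiemannianVolume

variable {n : ℕ} {M : Type*} [TopologicalSpace M] [ChartedSpace (Euc n) M] [IsManifold (𝓡 n) ∞ M]

/-- The derivative of the inverse of a chart, as a map between coordinate spaces. -/
noncomputable def chartFrame (e : OpenPartialHomeomorph M (Euc n)) (x : Euc n) :
    Euc n →L[ℝ] Euc n :=
  mfderiv (𝓡 n) (𝓡 n) e.symm x

/-- The metric at `p` as a form on the coordinate space underlying the tangent space. -/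
noncomputable def metricForm (g : RiemMetric n M) (p : M) : Euc n →L[ℝ] Euc n →L[ℝ] ℝ :=
  g.inner p

theorem gramMatrix_apply (g : RiemMetric n M) (e : OpenPartialHomeomorph M (Euc n)) (x : Euc n)
    (i j : Fin n) : gramMatrix g e x i j = metricForm g (e.symm x)
      (chartFrame e x (EuclideanSpace.single i 1)) (chartFrame e x (EuclideanSpace.single j 1)) :=
  rfl

theorem metricForm_symm (g : RiemMetric n M) (p : M) (v w : Euc n) :
    metricForm g p v w = metricForm g p w v := g.symm p v w

theorem metricForm_pos (g : RiemMetric n M) (p : M) {v : Euc n} (hv : v ≠ 0) :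
    0 < metricForm g p v v := g.pos p v hv

theorem mdifferentiableAt_symm {e : OpenPartialHomeomorph M (Euc n)} (he : e ∈ charts n M)
    {x : Euc n} (hx : x ∈ e.target) : MDifferentiableAt (𝓡 n) (𝓡 n) e.symm x :=
  (contMDiffAt_symm_of_mem_maximalAtlas he hx).mdifferentiableAt (by simp)

theorem mdifferentiableAt_chart {e : OpenPartialHomeomorph M (Euc n)} (he : e ∈ charts n M)
    {p : M} (hp : p ∈ e.source) : MDifferentiableAt (𝓡 n) (𝓡 n) e p :=
  (contMDiffAt_of_mem_maximalAtlas he hp).mdifferentiableAt (by simp)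

theorem chartFrame_injective {e : OpenPartialHomeomorph M (Euc n)} (he : e ∈ charts n M)
    {x : Euc n} (hx : x ∈ e.target) : Function.Injective (chartFrame e x) := by
  have h1 : mfderiv (𝓡 n) (𝓡 n) (e ∘ e.symm) x =
      (mfderiv (𝓡 n) (𝓡 n) e (e.symm x)).comp (mfderiv (𝓡 n) (𝓡 n) e.symm x) :=
    mfderiv_comp x (mdifferentiableAt_chart he (e.map_target hx)) (mdifferentiableAt_symm he hx)
  have h2 : (e ∘ e.symm) =ᶠ[𝓝 x] id := by
    filter_upwards [e.open_target.mem_nhds hx] with y hy using e.right_inv hy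
  rw [h2.mfderiv_eq, mfderiv_id] at h1
  intro v w hvw
  have hv := congrArg (fun L : Euc n →L[ℝ] Euc n => L v) h1
  have hw := congrArg (fun L : Euc n →L[ℝ] Euc n => L w) h1
  change v = (mfderiv (𝓡 n) (𝓡 n) e (e.symm x) : Euc n →L[ℝ] Euc n) (chartFrame e x v) at hv
  change w = (mfderiv (𝓡 n) (𝓡 n) e (e.symm x) : Euc n →L[ℝ] Euc n) (chartFrame e x w) at hw
  rw [hv, hvw, ← hw]

theorem sum_single_smul (v : Euc n) : v = ∑ i, v i • EuclideanSpace.single i (1 : ℝ) := by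
  conv_lhs => rw [← (EuclideanSpace.basisFun (Fin n) ℝ).sum_repr v]
  simp

theorem gramMatrix_det_pos (g : RiemMetric n M) {e : OpenPartialHomeomorph M (Euc n)}
    (he : e ∈ charts n M) {x : Euc n} (hx : x ∈ e.target) : 0 < (gramMatrix g e x).det := by
  refine Matrix.PosDef.det_pos (Matrix.PosDef.of_dotProduct_mulVec_pos ?_ ?_)
  · ext i j
    simp only [Matrix.conjTranspose_apply, gramMatrix_apply, star_trivial]
    exact metricForm_symm _ _ _ _
  · intro v hv
    have hv' : (WithLp.toLp 2 v : Euc n) ≠ 0 := fun h => hv (by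
      funext i
      exact congrArg (fun w : Euc n => w i) h)
    have h1 : star v ⬝ᵥ (gramMatrix g e x).mulVec v = metricForm g (e.symm x)
        (chartFrame e x (WithLp.toLp 2 v)) (chartFrame e x (WithLp.toLp 2 v)) := by
      conv_rhs => rw [sum_single_smul (WithLp.toLp 2 v : Euc n)]
      simp only [map_sum, map_smul, sum_apply, smul_apply,
        dotProduct, Matrix.mulVec, gramMatrix_apply, Finset.mul_sum, star_trivial, Pi.star_apply,
        smul_eq_mul]
      refine Eq.trans ?_ Finset.sum_comm
      refine Finset.sum_congr rfl fun i _ => Finset.sum_congr rfl fun j _ => ?_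
      ring
    rw [h1]
    refine metricForm_pos g _ fun h => hv' ?_
    exact chartFrame_injective he hx (h.trans (map_zero _).symm)

/-- The coordinate fields are the tangent map of `e.symm` applied to constant fields, hence
continuous along `e.symm`; the metric, a continuous section, is evaluated on them. -/
theorem continuousOn_gramMatrix (g : RiemMetric n M) {e : OpenPartialHomeomorph M (Euc n)}
    (he : e ∈ charts n M) (i j : Fin n) :
    ContinuousOn (fun x => gramMatrix g e x i j) e.target := by
  have hsymm : ContMDiffOn (𝓡 n) (𝓡 n) ∞ e.symm e.target :=
    contMDiffOn_symm_of_mem_maximalAtlas he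
  have htan := hsymm.contMDiffOn_tangentMapWithin (m := 0) (by simp)
    e.open_target.uniqueMDiffOn
  have hsec : ∀ v : Euc n, ContMDiffOn (𝓡 n) (𝓡 n).tangent 0
      (fun x => (⟨e.symm x, (chartFrame e x v : TangentSpace (𝓡 n) (e.symm x))⟩ :
        TangentBundle (𝓡 n) M)) e.target := by
    intro v
    have hconst : ContMDiffOn (𝓡 n) (𝓡 n).tangent 0
        (fun x => (⟨x, v⟩ : TangentBundle (𝓡 n) (Euc n))) e.target := by
      intro x _
      exact (contMDiffWithinAt_vectorSpace_iff_contDiffWithinAt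
        (V := fun _ : Euc n => v)).mpr contDiffWithinAt_const
    refine (htan.comp hconst fun x hx => hx).congr fun x hx => ?_
    simp only [Function.comp_apply, tangentMapWithin]
    rw [mfderivWithin_of_isOpen e.open_target hx]
    rfl
  have hg : ContMDiffOn (𝓡 n) ((𝓡 n).prod 𝓘(ℝ, Euc n →L[ℝ] Euc n →L[ℝ] ℝ)) 0
      (fun x => Bundle.TotalSpace.mk' (Euc n →L[ℝ] Euc n →L[ℝ] ℝ)
        (E := fun p : M => TangentSpace (𝓡 n) p →L[ℝ] TangentSpace (𝓡 n) p →L[ℝ] ℝ)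
        (e.symm x) (g.inner (e.symm x))) e.target :=
    (g.contMDiff.of_le (by simp)).comp_contMDiffOn (hsymm.of_le (by simp))
  have happ := ContMDiffOn.clm_bundle_apply₂ (F₁ := Euc n) (F₂ := Euc n) (F₃ := ℝ)
    (E₃ := Bundle.Trivial M ℝ) hg (hsec (EuclideanSpace.single i 1))
    (hsec (EuclideanSpace.single j 1))
  intro x hx
  have := happ x hx
  simp only [Bundle.contMDiffWithinAt_totalSpace] at this
  exact this.2.continuousWithinAt

theorem continuousOn_sqrt_det (g : RiemMetric n M) {e : OpenPartialHomeomorph M (Euc n)}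
    (he : e ∈ charts n M) : ContinuousOn (fun x => Real.sqrt (gramMatrix g e x).det) e.target := by
  have hG : ContinuousOn (fun x => gramMatrix g e x) e.target :=
    continuousOn_pi.mpr fun i => continuousOn_pi.mpr fun j => continuousOn_gramMatrix g he i j
  exact (Real.continuous_sqrt.comp continuous_id.matrix_det).comp_continuousOn hG

end RiemannianVolume

/-! ### Riemannian volume against Lebesgue measure in a chart. -/

section ChangeOfCharts

variable {n : ℕ} {M : Type*} [TopologicalSpace M] [ChartedSpace (Euc n) M] [IsManifold (𝓡 n) ∞ M]

theorem differentiableAt_transition {e e' : OpenPartialHomeomorph M (Euc n)}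
    (he : e ∈ charts n M) (he' : e' ∈ charts n M) {y : Euc n} (hy : y ∈ e'.target)
    (hy' : e'.symm y ∈ e.source) : DifferentiableAt ℝ (e ∘ e'.symm) y :=
  mdifferentiableAt_iff_differentiableAt.mp
    ((mdifferentiableAt_chart he hy').comp y (mdifferentiableAt_symm he' hy))

theorem chartFrame_transition {e e' : OpenPartialHomeomorph M (Euc n)}
    (he : e ∈ charts n M) (he' : e' ∈ charts n M) {y : Euc n} (hy : y ∈ e'.target)
    (hy' : e'.symm y ∈ e.source) :
    chartFrame e' y = (chartFrame e (e (e'.symm y))).comp (fderiv ℝ (e ∘ e'.symm) y) := by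
  have h2 : (e.symm ∘ (e ∘ e'.symm)) =ᶠ[𝓝 y] e'.symm := by
    have hc : ContinuousAt e'.symm y := e'.symm.continuousAt hy
    filter_upwards [hc.preimage_mem_nhds (e.open_source.mem_nhds hy')] with z hz
    exact e.left_inv hz
  have h1 : mfderiv (𝓡 n) (𝓡 n) (e.symm ∘ (e ∘ e'.symm)) y =
      (mfderiv (𝓡 n) (𝓡 n) e.symm ((e ∘ e'.symm) y)).comp
        (mfderiv (𝓡 n) (𝓡 n) (e ∘ e'.symm) y) :=
    mfderiv_comp y (mdifferentiableAt_symm he (e.map_source hy'))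
      (mdifferentiableAt_iff_differentiableAt.mpr (differentiableAt_transition he he' hy hy'))
  rw [h2.mfderiv_eq, mfderiv_eq_fderiv] at h1
  exact h1

/-- The Gram matrices are congruent through the Jacobian matrix `Q` of the transition map: `G' = Qᵀ
G Q`. -/
theorem sqrt_det_transition (g : RiemMetric n M) {e e' : OpenPartialHomeomorph M (Euc n)}
    (he : e ∈ charts n M) (he' : e' ∈ charts n M) {y : Euc n} (hy : y ∈ e'.target)
    (hy' : e'.symm y ∈ e.source) :
    Real.sqrt (gramMatrix g e' y).det = |(fderiv ℝ (e ∘ e'.symm) y).det| *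
      Real.sqrt (gramMatrix g e (e (e'.symm y))).det := by
  set J := fderiv ℝ (e ∘ e'.symm) y with hJ
  set b := (EuclideanSpace.basisFun (Fin n) ℝ).toBasis with hb
  set Q : Matrix (Fin n) (Fin n) ℝ := LinearMap.toMatrix b b (J : Euc n →ₗ[ℝ] Euc n) with hQ
  have hQdet : J.det = Q.det := (LinearMap.det_toMatrix b (J : Euc n →ₗ[ℝ] Euc n)).symm
  have hQe : ∀ k i, Q k i = J (EuclideanSpace.single i 1) k := by
    intro k i
    rw [hQ, LinearMap.toMatrix_apply]
    simp [hb]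
  have hgram : gramMatrix g e' y = Q.transpose * gramMatrix g e (e (e'.symm y)) * Q := by
    ext i j
    rw [gramMatrix_apply, chartFrame_transition he he' hy hy']
    have hp : e.symm (e (e'.symm y)) = e'.symm y := e.left_inv hy'
    rw [ContinuousLinearMap.comp_apply, ContinuousLinearMap.comp_apply, ← hJ,
      sum_single_smul (J (EuclideanSpace.single i 1)),
      sum_single_smul (J (EuclideanSpace.single j 1))]
    simp only [map_sum, map_smul, sum_apply, smul_apply, smul_eq_mul, Matrix.mul_apply,
      Matrix.transpose_apply, gramMatrix_apply, hp, hQe, Finset.sum_mul]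
    refine Finset.sum_congr rfl fun k _ => ?_
    rw [Finset.mul_sum]
    exact Finset.sum_congr rfl fun l _ => by ring
  rw [hgram, Matrix.det_mul, Matrix.det_mul, Matrix.det_transpose, hQdet,
    mul_right_comm, Real.sqrt_mul (mul_self_nonneg _), Real.sqrt_mul_self_eq_abs]

variable [MeasurableSpace M] [BorelSpace M]

theorem aemeasurable_symm (e : OpenPartialHomeomorph M (Euc n)) :
    AEMeasurable e.symm ((volume : Measure (Euc n)).restrict e.target) :=
  e.continuousOn_symm.aemeasurable e.open_target.measurableSet

theorem measurableSet_target_inter_preimage (e : OpenPartialHomeomorph M (Euc n)) {S : Set M}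
    (hS : MeasurableSet S) : MeasurableSet (e.target ∩ e.symm ⁻¹' S) := by
  have h : Measurable (e.target.domRestrict e.symm) :=
    (continuousOn_iff_continuous_domRestrict.mp e.continuousOn_symm).measurable
  have := e.open_target.measurableSet.subtype_image (h hS)
  convert! this using 1
  ext x
  simp [Set.domRestrict, and_comm]

theorem chartVolume_apply (g : RiemMetric n M) (e : OpenPartialHomeomorph M (Euc n)) {S : Set M}
    (hS : MeasurableSet S) : chartVolume g e S =
      ∫⁻ x in e.target ∩ e.symm ⁻¹' S, ENNReal.ofReal (Real.sqrt (gramMatrix g e x).det) := by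
  rw [chartVolume, Measure.map_apply_of_aemeasurable
    ((aemeasurable_symm e).mono_ac (withDensity_absolutelyContinuous _ _)) hS, withDensity_apply',
    Measure.restrict_restrict' e.open_target.measurableSet, Set.inter_comm]

theorem chartVolume_inter_source_le (g : RiemMetric n M) {e e' : OpenPartialHomeomorph M (Euc n)}
    (he : e ∈ charts n M) (he' : e' ∈ charts n M) {S : Set M} (hS : MeasurableSet S) :
    chartVolume g e' (S ∩ e.source) ≤ chartVolume g e S := by
  rw [chartVolume_apply g e' (hS.inter e.open_source.measurableSet), chartVolume_apply g e hS]
  set T := e'.target ∩ e'.symm ⁻¹' (S ∩ e.source) with hT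
  have hTm : MeasurableSet T :=
    measurableSet_target_inter_preimage e' (hS.inter e.open_source.measurableSet)
  have hinj : Set.InjOn (e ∘ e'.symm) T := by
    intro x hx y hy hxy
    exact e'.symm.injOn hx.1 hy.1 (e.injOn hx.2.2 hy.2.2 hxy)
  have himg : (e ∘ e'.symm) '' T ⊆ e.target ∩ e.symm ⁻¹' S := by
    rintro _ ⟨y, hy, rfl⟩
    refine ⟨e.map_source hy.2.2, ?_⟩
    change e.symm (e (e'.symm y)) ∈ S
    rw [e.left_inv hy.2.2]
    exact hy.2.1
  refine le_trans (le_of_eq ?_) (lintegral_mono_set himg)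
  rw [lintegral_image_eq_lintegral_abs_det_fderiv_mul volume hTm
    (fun y hy => (differentiableAt_transition he he' hy.1 hy.2.2).hasFDerivAt.hasFDerivWithinAt)
    hinj]
  refine setLIntegral_congr_fun hTm fun y hy => ?_
  simp only [Function.comp_apply]
  rw [sqrt_det_transition g he he' hy.1 hy.2.2, ENNReal.ofReal_mul (abs_nonneg _)]

theorem chartVolume_le_vol (g : RiemMetric n M) {e : OpenPartialHomeomorph M (Euc n)}
    (he : e ∈ charts n M) : chartVolume g e ≤ vol g :=
  le_iSup₂ (f := fun e' (_ : e' ∈ charts n M) => chartVolume g e') e he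

theorem vol_le_chartVolume (g : RiemMetric n M) {e : OpenPartialHomeomorph M (Euc n)}
    (he : e ∈ charts n M) {S : Set M} (hS : MeasurableSet S) (hSe : S ⊆ e.source) :
    vol g S ≤ chartVolume g e S := by
  -- `vol g` is a supremum of measures, so it suffices that the right side dominates each chart
  -- measure. Inside `e.source` this is the change of variables; outside it is the definition of
  -- `vol g`.
  have h : vol g ≤ chartVolume g e + (vol g).restrict e.sourceᶜ := by
    refine iSup₂_le fun e' he' => Measure.le_iff.mpr fun T hT => ?_
    rw [Measure.add_apply, Measure.restrict_apply hT,
      ← measure_inter_add_sdiff T e.open_source.measurableSet]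
    exact add_le_add (chartVolume_inter_source_le g he he' hT) (chartVolume_le_vol g he' _)
  refine (h S).trans ?_
  rw [Measure.add_apply, Measure.restrict_apply hS,
    Set.disjoint_iff_inter_eq_empty.mp (Set.disjoint_compl_right_iff_subset.mpr hSe),
    measure_empty, add_zero]

/-- The image on `M` of Lebesgue measure on a set of coordinates. -/
noncomputable def chartLebesgue (e : OpenPartialHomeomorph M (Euc n)) (K : Set (Euc n)) :
    Measure M :=
  (volume.restrict K).map e.symm

theorem aemeasurable_symm_restrict (e : OpenPartialHomeomorph M (Euc n)) {K : Set (Euc n)}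
    (hK : K ⊆ e.target) : AEMeasurable e.symm ((volume : Measure (Euc n)).restrict K) :=
  (aemeasurable_symm e).mono_measure (Measure.restrict_mono hK le_rfl)

theorem chartLebesgue_apply (e : OpenPartialHomeomorph M (Euc n)) {K : Set (Euc n)}
    (hKm : MeasurableSet K) (hK : K ⊆ e.target) {S : Set M} (hS : MeasurableSet S) :
    chartLebesgue e K S = volume (e.symm ⁻¹' S ∩ K) := by
  rw [chartLebesgue, Measure.map_apply_of_aemeasurable (aemeasurable_symm_restrict e hK) hS,
    Measure.restrict_apply' hKm]

theorem exists_vol_restrict_le [T2Space M] (g : RiemMetric n M)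
    {e : OpenPartialHomeomorph M (Euc n)} (he : e ∈ charts n M) {K : Set (Euc n)}
    (hK : IsCompact K) (hKe : K ⊆ e.target) :
    ∃ C : NNReal, (vol g).restrict (e.symm '' K) ≤ C • chartLebesgue e K := by
  obtain ⟨C, hC⟩ := (hK.image_of_continuousOn ((continuousOn_sqrt_det g he).mono hKe)).bddAbove
  have himg : MeasurableSet (e.symm '' K) :=
    (hK.image_of_continuousOn (e.continuousOn_symm.mono hKe)).measurableSet
  refine ⟨C.toNNReal, Measure.le_iff.mpr fun S hS => ?_⟩
  rw [Measure.restrict_apply hS]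
  refine (vol_le_chartVolume g he (hS.inter himg) ?_).trans ?_
  · rintro _ ⟨_, x, hx, rfl⟩
    exact e.map_target (hKe hx)
  rw [chartVolume_apply g e (hS.inter himg), Measure.smul_apply,
    chartLebesgue_apply e hK.measurableSet hKe hS]
  have hset : e.target ∩ e.symm ⁻¹' (S ∩ e.symm '' K) = e.symm ⁻¹' S ∩ K := by
    ext x
    constructor
    · rintro ⟨hx, hxS, y, hy, hxy⟩
      have : y = x := e.symm.injOn (hKe hy) hx hxy
      exact ⟨hxS, this ▸ hy⟩
    · rintro ⟨hxS, hxK⟩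
      exact ⟨hKe hxK, hxS, x, hxK, rfl⟩
  rw [hset]
  have hm : MeasurableSet (e.symm ⁻¹' S ∩ K) := by
    rw [← hset]
    exact measurableSet_target_inter_preimage e (hS.inter himg)
  refine (setLIntegral_mono' hm (g := fun _ => ENNReal.ofReal C) fun x hx =>
    ENNReal.ofReal_le_ofReal (hC ⟨x, hx.2, rfl⟩)).trans_eq ?_
  rw [setLIntegral_const]
  rfl

/-- The density is continuous and positive, so it has a positive minimum on a nonempty compact set.
Besides the norm bound, this yields the absolute continuity that lets almost-everywhere classes on
`M` be read in coordinates. -/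
theorem exists_chartLebesgue_le (g : RiemMetric n M)
    {e : OpenPartialHomeomorph M (Euc n)} (he : e ∈ charts n M) {K : Set (Euc n)}
    (hK : IsCompact K) (hKe : K ⊆ e.target) :
    ∃ C : NNReal, chartLebesgue e K ≤ C • vol g := by
  obtain ⟨c, hc0, hc⟩ : ∃ c : ℝ, 0 < c ∧ ∀ x ∈ K, c ≤ Real.sqrt (gramMatrix g e x).det := by
    rcases K.eq_empty_or_nonempty with rfl | hne
    · exact ⟨1, one_pos, fun x hx => hx.elim⟩
    · obtain ⟨x, hx, hmin⟩ := hK.exists_isMinOn hne ((continuousOn_sqrt_det g he).mono hKe)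
      exact ⟨_, Real.sqrt_pos.mpr (gramMatrix_det_pos g he (hKe hx)), fun y hy => hmin hy⟩
  refine ⟨(c⁻¹).toNNReal, Measure.le_iff.mpr fun S hS => ?_⟩
  have hsub : e.symm ⁻¹' S ∩ K ⊆ e.target ∩ e.symm ⁻¹' S := fun x hx => ⟨hKe hx.2, hx.1⟩
  have hm : MeasurableSet (e.symm ⁻¹' S ∩ K) := by
    have : e.symm ⁻¹' S ∩ K = (e.target ∩ e.symm ⁻¹' S) ∩ K := by
      ext x
      exact ⟨fun hx => ⟨hsub hx, hx.2⟩, fun hx => ⟨hx.1.2, hx.2⟩⟩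
    rw [this]
    exact (measurableSet_target_inter_preimage e hS).inter hK.measurableSet
  rw [chartLebesgue_apply e hK.measurableSet hKe hS, Measure.smul_apply]
  change _ ≤ ENNReal.ofReal c⁻¹ * vol g S
  have h1 : ENNReal.ofReal c * volume (e.symm ⁻¹' S ∩ K) ≤ vol g S := by
    refine le_trans ?_ (chartVolume_le_vol g he S)
    rw [chartVolume_apply g e hS, ← setLIntegral_const]
    exact (setLIntegral_mono' hm fun x hx => ENNReal.ofReal_le_ofReal (hc x hx.2)).trans
      (lintegral_mono_set hsub)
  rw [ENNReal.ofReal_inv_of_pos hc0, mul_comm, ← div_eq_mul_inv,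
    ENNReal.le_div_iff_mul_le (Or.inl (by simpa using hc0)) (Or.inl ENNReal.ofReal_ne_top), mul_comm]
  exact h1

theorem measurable_pullback (e : OpenPartialHomeomorph M (Euc n)) {w : Euc n → ℂ}
    (hw : Measurable w) : Measurable (pullback e w) := by
  have h : Measurable (e.source.domRestrict e) :=
    (continuousOn_iff_continuous_domRestrict.mp e.continuousOn).measurable
  refine measurable_of_restrict_of_restrict_compl e.open_source.measurableSet ?_ ?_
  · have : e.source.domRestrict (pullback e w) = w ∘ e.source.domRestrict e := by
      funext p
      simp [pullback, Set.domRestrict, p.2]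
    rw [this]
    exact hw.comp h
  · have : e.sourceᶜ.domRestrict (pullback e w) = fun _ => 0 := by
      funext p
      change pullback e w p = 0
      rw [pullback, Set.indicator_of_notMem p.2]
    rw [this]
    exact measurable_const

theorem pullback_symm (e : OpenPartialHomeomorph M (Euc n)) (w : Euc n → ℂ) {x : Euc n}
    (hx : x ∈ e.target) : pullback e w (e.symm x) = w x := by
  rw [pullback, Set.indicator_of_mem (e.map_target hx), e.right_inv hx]

theorem eLpNorm_chartLebesgue (e : OpenPartialHomeomorph M (Euc n)) {K : Set (Euc n)}
    (hK : K ⊆ e.target) {h : M → ℂ} (hh : AEStronglyMeasurable h (chartLebesgue e K)) :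
    eLpNorm h 2 (chartLebesgue e K) = eLpNorm (fun x => h (e.symm x)) 2 (volume.restrict K) :=
  eLpNorm_map_measure hh (aemeasurable_symm_restrict e hK)

/-- On a compact subset of a chart domain, `L²(M)`-norms are bounded by Lebesgue norms in the
coordinates. -/
theorem exists_eLpNorm_indicator_le [T2Space M] (g : RiemMetric n M)
    {e : OpenPartialHomeomorph M (Euc n)} (he : e ∈ charts n M) {K : Set (Euc n)}
    (hK : IsCompact K) (hKe : K ⊆ e.target) :
    ∃ C : NNReal, ∀ h : M → ℂ, AEStronglyMeasurable h (vol g) →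
      eLpNorm ((e.symm '' K).indicator h) 2 (vol g) ≤
        C * eLpNorm (fun x => h (e.symm x)) 2 (volume.restrict K) := by
  obtain ⟨C, hC⟩ := exists_vol_restrict_le g he hK hKe
  obtain ⟨C', hC'⟩ := exists_chartLebesgue_le g he hK hKe
  have himg : MeasurableSet (e.symm '' K) :=
    (hK.image_of_continuousOn (e.continuousOn_symm.mono hKe)).measurableSet
  refine ⟨C ^ (1 / (2 : ℝ)), fun h hh => ?_⟩
  have hac : chartLebesgue e K ≪ vol g := Measure.absolutelyContinuous_of_le_smul hC'
  rw [eLpNorm_indicator_eq_eLpNorm_restrict himg, ← eLpNorm_chartLebesgue e hKe (hh.mono_ac hac)]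
  refine (eLpNorm_mono_measure h hC).trans_eq ?_
  rw [eLpNorm_smul_measure_of_ne_top' (by simp)]
  simp [ENNReal.smul_def]

/-- On a compact subset of a chart domain, Lebesgue norms in the coordinates are bounded by
`L²(M)`-norms. -/
theorem exists_eLpNorm_restrict_le (g : RiemMetric n M)
    {e : OpenPartialHomeomorph M (Euc n)} (he : e ∈ charts n M) {K : Set (Euc n)}
    (hK : IsCompact K) (hKe : K ⊆ e.target) :
    ∃ C : NNReal, ∀ h : M → ℂ, AEStronglyMeasurable h (vol g) →
      eLpNorm (fun x => h (e.symm x)) 2 (volume.restrict K) ≤ C * eLpNorm h 2 (vol g) := by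
  obtain ⟨C, hC⟩ := exists_chartLebesgue_le g he hK hKe
  refine ⟨C ^ (1 / (2 : ℝ)), fun h hh => ?_⟩
  have hac : chartLebesgue e K ≪ vol g := Measure.absolutelyContinuous_of_le_smul hC
  rw [← eLpNorm_chartLebesgue e hKe (hh.mono_ac hac)]
  refine (eLpNorm_mono_measure h hC).trans_eq ?_
  rw [eLpNorm_smul_measure_of_ne_top' (by simp)]
  simp [ENNReal.smul_def]

end ChangeOfCharts

/-! ### Operator norm of a localized difference in terms of symbols. -/

section LocalEstimate

variable {n : ℕ}

theorem iteratedFDeriv_bounded_of_hasCompactSupport {φ : Euc n → ℂ} (hφ : ContDiff ℝ ∞ φ)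
    (hc : HasCompactSupport φ) (m : ℕ) :
    ∃ B : ℝ, 0 ≤ B ∧ ∀ k ≤ m, ∀ x, ‖iteratedFDeriv ℝ k φ x‖ ≤ B := by
  have h : ∀ k : ℕ, ∃ B : ℝ, ∀ x, ‖iteratedFDeriv ℝ k φ x‖ ≤ B := fun k =>
    (hφ.continuous_iteratedFDeriv (m := k) (by exact_mod_cast le_top)).bounded_above_of_compact_support
      (hc.iteratedFDeriv k)
  choose B hB using h
  refine ⟨∑ k ∈ Finset.range (m + 1), |B k|, Finset.sum_nonneg fun _ _ => abs_nonneg _,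
    fun k hk x => (hB k x).trans ((le_abs_self _).trans ?_)⟩
  exact Finset.single_le_sum (f := fun k => |B k|) (fun _ _ => abs_nonneg _)
    (Finset.mem_range.mpr (by omega))

/-- Leibniz' rule on the support of `φ`, where alone `c` is controlled; off this support the product
and all its derivatives vanish. -/
theorem norm_iteratedFDeriv_cutoff_mul_le {φ c : Euc n → ℂ} (hφ : ContDiff ℝ ∞ φ)
    (hc : ContDiff ℝ ∞ c) {m : ℕ} {B η : ℝ} (hB : ∀ k ≤ m, ∀ x, ‖iteratedFDeriv ℝ k φ x‖ ≤ B)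
    (hη0 : 0 ≤ η) (hη : ∀ k ≤ m, ∀ x ∈ tsupport φ, ‖iteratedFDeriv ℝ k c x‖ ≤ η)
    {k : ℕ} (hk : k ≤ m) (x : Euc n) :
    ‖iteratedFDeriv ℝ k (fun y => φ y * c y) x‖ ≤ 2 ^ m * B * η := by
  have hB0 : 0 ≤ B := (norm_nonneg _).trans (hB 0 (Nat.zero_le _) x)
  by_cases hx : x ∈ tsupport φ
  · refine (norm_iteratedFDeriv_mul_le hφ hc x (n := k) (by exact_mod_cast le_top)).trans ?_
    calc ∑ i ∈ Finset.range (k + 1), (k.choose i : ℝ) * ‖iteratedFDeriv ℝ i φ x‖ *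
          ‖iteratedFDeriv ℝ (k - i) c x‖
        ≤ ∑ i ∈ Finset.range (k + 1), (k.choose i : ℝ) * B * η := by
          refine Finset.sum_le_sum fun i hi => ?_
          have hi' : i ≤ m := by have := Finset.mem_range.mp hi; omega
          have := hB i hi' x
          have := hη (k - i) (by omega) x hx
          gcongr
      _ = 2 ^ k * B * η := by
          rw [← Finset.sum_mul, ← Finset.sum_mul]
          congr 2
          exact_mod_cast Nat.sum_range_choose k
      _ ≤ 2 ^ m * B * η := by
          gcongr
          norm_num
  · have h0 : iteratedFDeriv ℝ k (fun y => φ y * c y) x = 0 := by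
      by_contra hne
      have h1 : x ∈ tsupport (fun y => φ y * c y) :=
        tsupport_iteratedFDeriv_subset k (subset_tsupport _ hne)
      exact hx (tsupport_mul_subset_left h1)
    rw [h0, norm_zero]
    positivity

theorem exists_schwartz_eLpNorm_sub_le {w : Euc n → ℂ} (hw : MemLp w 2 volume) {ε : ℝ}
    (hε : 0 < ε) : ∃ u : 𝓢(Euc n, ℂ), eLpNorm (fun x => w x - u x) 2 volume ≤ ENNReal.ofReal ε := by
  obtain ⟨u, hu⟩ := (SchwartzMap.denseRange_toLpCLM (F := ℂ) (p := 2)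
    (μ := (volume : Measure (Euc n))) ENNReal.ofNat_ne_top).exists_dist_lt (hw.toLp w) hε
  refine ⟨u, ?_⟩
  have h : edist (hw.toLp w) ((u.memLp 2 volume).toLp u) = eLpNorm (w - ⇑u) 2 volume :=
    Lp.edist_toLp_toLp _ _ hw (u.memLp 2 volume)
  change eLpNorm (w - ⇑u) 2 volume ≤ _
  rw [← h, edist_dist]
  exact ENNReal.ofReal_le_ofReal hu.le

/-- A left factor depending on `x` alone passes into the symbol. This supplies the compact
`x`-support that the `L²` bound needs and that `a - a'` need not have. -/
theorem Op_sub {a a' : Euc n → Euc n → ℂ} (ha : IsClassicalSymbol a) (ha' : IsClassicalSymbol a')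
    (φ : Euc n → ℂ) (u : 𝓢(Euc n, ℂ)) (x : Euc n) :
    φ x * (Op a u x - Op a' u x) = Op (fun x ξ => φ x * (a x ξ - a' x ξ)) u x := by
  have hint : ∀ {c : Euc n → Euc n → ℂ}, IsClassicalSymbol c → Integrable (opKernel c u x) := by
    intro c hc
    obtain ⟨C, hC⟩ := hc.estimates 0 0
    refine integrable_opKernel hc.smooth.continuous (η := C) (fun y ξ => ?_) u x
    simpa [norm_iteratedFDeriv_zero] using hC y ξ (Set.mem_univ _)
  simp only [Op_eq_integral_opKernel]
  rw [← integral_sub (hint ha) (hint ha'), ← integral_const_mul]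
  congr 1
  funext ξ
  simp only [opKernel]
  ring

variable {M : Type*} [TopologicalSpace M] [ChartedSpace (Euc n) M] [IsManifold (𝓡 n) ∞ M]
  [MeasurableSpace M]

/-- Multiplication by the indicator function of a measurable set, on `L²(M)`. -/
noncomputable def indicatorOp (g : RiemMetric n M) {S : Set M} (hS : MeasurableSet S) :
    L2 g →L[ℂ] L2 g :=
  LinearMap.mkContinuous
    { toFun := fun f => ((Lp.memLp f).indicator hS).toLp
      map_add' := fun f h => by
        rw [← MemLp.toLp_add, MemLp.toLp_eq_toLp_iff]
        filter_upwards [Lp.coeFn_add f h] with p hp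
        by_cases hpS : p ∈ S
        · rw [Pi.add_apply, Set.indicator_of_mem hpS, Set.indicator_of_mem hpS,
            Set.indicator_of_mem hpS, hp, Pi.add_apply]
        · simp [hpS]
      map_smul' := fun c f => by
        rw [RingHom.id_apply, ← MemLp.toLp_const_smul, MemLp.toLp_eq_toLp_iff]
        filter_upwards [Lp.coeFn_smul c f] with p hp
        by_cases hpS : p ∈ S
        · simp [hpS, hp]
        · simp [hpS] } 1 fun f => by
    rw [one_mul, LinearMap.coe_mk, AddHom.coe_mk, Lp.norm_toLp, Lp.norm_def]
    exact ENNReal.toReal_mono (Lp.eLpNorm_ne_top f) (eLpNorm_indicator_le _)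

theorem indicatorOp_apply (g : RiemMetric n M) {S : Set M} (hS : MeasurableSet S) (f : L2 g) :
    indicatorOp g hS f = ((Lp.memLp f).indicator hS).toLp := rfl

theorem norm_indicatorOp_apply_le (g : RiemMetric n M) {S : Set M} (hS : MeasurableSet S)
    (f : L2 g) : ‖indicatorOp g hS f‖ ≤ ‖f‖ := by
  rw [indicatorOp_apply, Lp.norm_toLp, Lp.norm_def]
  exact ENNReal.toReal_mono (Lp.eLpNorm_ne_top f) (eLpNorm_indicator_le _)

variable [BorelSpace M] [T2Space M]

theorem pullback_eq_zero_of_notMem (e : OpenPartialHomeomorph M (Euc n)) {w : Euc n → ℂ}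
    {L : Set (Euc n)} (hw : ∀ x ∉ L, w x = 0) {p : M} (hp : p ∉ e.symm '' L) :
    pullback e w p = 0 := by
  rw [pullback]
  by_cases hps : p ∈ e.source
  · rw [Set.indicator_of_mem hps]
    exact hw _ fun h => hp ⟨e p, h, e.left_inv hps⟩
  · rw [Set.indicator_of_notMem hps]

theorem enorm_eq_eLpNorm {g : RiemMetric n M} (f : L2 g) : ‖f‖ₑ = eLpNorm f 2 (vol g) :=
  Lp.enorm_def f

/-- The local estimate on functions that are cut off in the chart. -/
theorem exists_norm_indicator_sub_le (g : RiemMetric n M) {e : OpenPartialHomeomorph M (Euc n)}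
    (he : e ∈ charts n M) {φ : Euc n → ℂ} (hφ : IsCutoff e.target φ) {K : Set (Euc n)}
    (hK : IsCompact K) (hKe : K ⊆ e.target) (hφK : ∀ x ∈ K, φ x = 1)
    {S : Set M} (hS : MeasurableSet S) (hSK : S ⊆ e.symm '' K) :
    ∃ C : ℝ, 0 ≤ C ∧ ∀ (A A' : L2 g →L[ℂ] L2 g) (a a' : Euc n → Euc n → ℂ),
      IsLocalSymbol g A e φ φ a → IsLocalSymbol g A' e φ φ a' → ∀ η : ℝ, 0 ≤ η →
      (∀ k ≤ n + 1, ∀ x ∈ tsupport φ, ∀ ξ,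
        ‖iteratedFDeriv ℝ k (fun y => a y ξ - a' y ξ) x‖ ≤ η) →
      ∀ (u : 𝓢(Euc n, ℂ)) (f : L2 g), f =ᵐ[vol g] pullback e (fun x => φ x * u x) →
        ‖indicatorOp g hS ((A - A') f)‖ₑ ≤ ENNReal.ofReal (C * η) * eLpNorm u 2 volume := by
  obtain ⟨B, hB0, hB⟩ := iteratedFDeriv_bounded_of_hasCompactSupport hφ.smooth hφ.compact (n + 1)
  obtain ⟨C₁, hC₁, hOp⟩ := exists_eLpNorm_Op_le (n := n) hφ.compact
  obtain ⟨C₂, hC₂⟩ := exists_eLpNorm_indicator_le g he hK hKe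
  refine ⟨C₂ * (C₁ * (2 ^ (n + 1) * B)), by positivity, ?_⟩
  intro A A' a a' ha ha' η hη0 hη u f hf
  have hsm : ∀ {c : Euc n → Euc n → ℂ}, IsClassicalSymbol c → ∀ ξ, ContDiff ℝ ∞ fun x => c x ξ :=
    fun hc ξ => hc.smooth.comp (contDiff_id.prodMk contDiff_const)
  set b : Euc n → Euc n → ℂ := fun x ξ => φ x * (a x ξ - a' x ξ) with hb
  have hbound := hOp b (2 ^ (n + 1) * B * η)
    ((hφ.smooth.continuous.comp continuous_fst).mul
      (ha.1.smooth.continuous.sub ha'.1.smooth.continuous))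
    (fun ξ => hφ.smooth.mul ((hsm ha.1 ξ).sub (hsm ha'.1 ξ)))
    (fun ξ => tsupport_mul_subset_left)
    (fun k hk x ξ => norm_iteratedFDeriv_cutoff_mul_le hφ.smooth
      ((hsm ha.1 ξ).sub (hsm ha'.1 ξ)) hB hη0 (fun k hk x hx => hη k hk x hx ξ) hk x) u
  set h : M → ℂ := fun p => (A f : M → ℂ) p - (A' f : M → ℂ) p with hh
  have hmeas : AEStronglyMeasurable h (vol g) :=
    (Lp.aestronglyMeasurable (A f)).sub (Lp.aestronglyMeasurable (A' f))
  have h1 : ‖indicatorOp g hS ((A - A') f)‖ₑ = eLpNorm (S.indicator h) 2 (vol g) := by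
    rw [indicatorOp_apply, Lp.enorm_toLp]
    refine eLpNorm_congr_ae ?_
    have : ((A - A') f : L2 g) = A f - A' f := sub_apply _ _ _
    rw [this]
    filter_upwards [Lp.coeFn_sub (A f) (A' f)] with p hp
    by_cases hpS : p ∈ S
    · rw [Set.indicator_of_mem hpS, Set.indicator_of_mem hpS, hp, Pi.sub_apply]
    · simp [hpS]
  have h2 : eLpNorm (S.indicator h) 2 (vol g) ≤
      eLpNorm ((e.symm '' K).indicator h) 2 (vol g) := by
    refine eLpNorm_mono fun p => ?_
    by_cases hpS : p ∈ S
    · rw [Set.indicator_of_mem hpS, Set.indicator_of_mem (hSK hpS)]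
    · rw [Set.indicator_of_notMem hpS, norm_zero]
      exact norm_nonneg _
  -- On `K` both the factor `φ` in the definition of a local symbol and the extra one in `b` equal
  -- one, so `h ∘ e.symm` agrees there with `Op b u`.
  have h3 : eLpNorm (fun x => h (e.symm x)) 2 (volume.restrict K) ≤ eLpNorm (Op b u) 2 volume := by
    refine le_trans (le_of_eq ?_) (eLpNorm_restrict_le _ _ _ K)
    refine eLpNorm_congr_ae ?_
    filter_upwards [ae_restrict_of_ae (ha.2 u f hf), ae_restrict_of_ae (ha'.2 u f hf),
      ae_restrict_mem hK.measurableSet] with x hx hx' hxK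
    rw [← Op_sub ha.1 ha'.1, ← hx, ← hx', hφK x hxK]
    simp [hh]
  rw [h1]
  refine h2.trans ((hC₂ h hmeas).trans ?_)
  calc (C₂ : ENNReal) * eLpNorm (fun x => h (e.symm x)) 2 (volume.restrict K)
      ≤ C₂ * (ENNReal.ofReal (C₁ * (2 ^ (n + 1) * B * η)) * eLpNorm u 2 volume) := by
        gcongr
        exact h3.trans hbound
    _ = _ := by
        have e1 : (C₂ : ℝ) * (C₁ * (2 ^ (n + 1) * B)) * η =
          C₂ * (C₁ * (2 ^ (n + 1) * B * η)) := by ring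
        rw [e1, ENNReal.ofReal_mul (p := (C₂ : ℝ)) C₂.2, ENNReal.ofReal_coe_nnreal,
          mul_assoc (C₂ : ENNReal)]

/-- Functions supported in a compact subset of a chart are approximated by cut-off Schwartz
functions in the coordinates. -/
theorem exists_schwartz_approx (g : RiemMetric n M) {e : OpenPartialHomeomorph M (Euc n)}
    (he : e ∈ charts n M) {φ : Euc n → ℂ} (hφ : IsCutoff e.target φ) {K : Set (Euc n)}
    (hK : IsCompact K) (hKe : K ⊆ e.target) (hφK : ∀ x ∈ K, φ x = 1)
    {S : Set M} (hS : MeasurableSet S) (hSK : S ⊆ e.symm '' K) :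
    ∃ C : ℝ, 0 ≤ C ∧ ∀ (f : L2 g) (ε : ℝ), 0 < ε → ∃ (u : 𝓢(Euc n, ℂ)) (f' : L2 g),
      f' =ᵐ[vol g] pullback e (fun x => φ x * u x) ∧
      ‖indicatorOp g hS f - f'‖ ≤ C * ε ∧
      eLpNorm u 2 volume ≤ ENNReal.ofReal (C * ‖f‖ + ε) := by
  obtain ⟨B, hB0, hB⟩ := iteratedFDeriv_bounded_of_hasCompactSupport hφ.smooth hφ.compact 0
  have hφB : ∀ x, ‖φ x‖ ≤ B := fun x => by simpa using hB 0 le_rfl x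
  have hLe : tsupport φ ⊆ e.target := hφ.subset
  obtain ⟨C₁, hC₁⟩ := exists_eLpNorm_indicator_le g he hφ.compact.isCompact hLe
  obtain ⟨C₂, hC₂⟩ := exists_eLpNorm_restrict_le g he hK hKe
  have hC₁₀ : (0 : ℝ) ≤ C₁ := C₁.2
  have hC₂₀ : (0 : ℝ) ≤ C₂ := C₂.2
  refine ⟨C₁ * B + C₂, by positivity, fun f ε hε => ?_⟩
  set F : M → ℂ := S.indicator f with hF
  have hFm : StronglyMeasurable F := (Lp.stronglyMeasurable f).indicator hS
  have hFf : eLpNorm F 2 (vol g) ≤ ENNReal.ofReal ‖f‖ := by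
    rw [ofReal_norm, enorm_eq_eLpNorm]
    exact eLpNorm_indicator_le _
  -- `F` in coordinates, extended by zero. As `φ = 1` on `K`, `F ∘ e.symm = φ w` on the support of
  -- `φ`, so approximating `w` by `u` approximates `F` by `(φ u) ∘ e`.
  set w : Euc n → ℂ := K.indicator (fun x => F (e.symm x)) with hw
  have hwn : eLpNorm w 2 volume ≤ ENNReal.ofReal (C₂ * ‖f‖) := by
    rw [hw, eLpNorm_indicator_eq_eLpNorm_restrict hK.measurableSet]
    refine (hC₂ F hFm.aestronglyMeasurable).trans ?_
    rw [ENNReal.ofReal_mul hC₂₀, ENNReal.ofReal_coe_nnreal]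
    gcongr
  have hwm : MemLp w 2 volume := by
    refine ⟨?_, hwn.trans_lt ENNReal.ofReal_lt_top⟩
    rw [hw, aestronglyMeasurable_indicator_iff hK.measurableSet]
    exact (hFm.measurable.comp_aemeasurable
      (aemeasurable_symm_restrict e hKe)).aestronglyMeasurable
  obtain ⟨u, hu⟩ := exists_schwartz_eLpNorm_sub_le hwm hε
  have hq : Measurable (pullback e fun x => φ x * u x) :=
    measurable_pullback e (hφ.smooth.continuous.mul u.continuous).measurable
  have hzero : ∀ x ∉ tsupport φ, φ x * u x = 0 := fun x hx => by
    rw [image_eq_zero_of_notMem_tsupport hx, zero_mul]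
  have hKL : K ⊆ tsupport φ := fun x hx => subset_tsupport _ (by
    rw [Function.mem_support, hφK x hx]; exact one_ne_zero)
  have hdiff : eLpNorm (fun p => F p - pullback e (fun x => φ x * u x) p) 2 (vol g) ≤
      ENNReal.ofReal (C₁ * B * ε) := by
    have hind : (fun p => F p - pullback e (fun x => φ x * u x) p) =
        (e.symm '' tsupport φ).indicator
          (fun p => F p - pullback e (fun x => φ x * u x) p) := by
      funext p
      by_cases hp : p ∈ e.symm '' tsupport φ
      · rw [Set.indicator_of_mem hp]
      · have hpS : p ∉ S := fun h => hp (Set.image_mono hKL (hSK h))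
        rw [Set.indicator_of_notMem hp, pullback_eq_zero_of_notMem e hzero hp, hF,
          Set.indicator_of_notMem hpS, sub_zero]
    rw [hind]
    refine (hC₁ _ (hFm.measurable.sub hq).aestronglyMeasurable).trans ?_
    have hpt : ∀ᵐ x ∂(volume.restrict (tsupport φ)),
        ‖F (e.symm x) - pullback e (fun x => φ x * u x) (e.symm x)‖ ≤ B * ‖w x - u x‖ := by
      filter_upwards [ae_restrict_mem (isClosed_tsupport φ).measurableSet] with x hx
      rw [pullback_symm e _ (hLe hx)]
      have : F (e.symm x) = φ x * w x := by
        by_cases hxK : x ∈ K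
        · rw [hw, Set.indicator_of_mem hxK, hφK x hxK, one_mul]
        · have hxS : e.symm x ∉ S := by
            intro h
            obtain ⟨y, hy, hyx⟩ := hSK h
            exact hxK (e.symm.injOn (hKe hy) (hLe hx) hyx ▸ hy)
          rw [hw, Set.indicator_of_notMem hxK, hF, Set.indicator_of_notMem hxS, mul_zero]
      rw [this, ← mul_sub, norm_mul]
      exact mul_le_mul_of_nonneg_right (hφB x) (norm_nonneg _)
    have h1 := eLpNorm_le_mul_eLpNorm_of_ae_le_mul hpt 2
    calc (C₁ : ENNReal) * eLpNorm
          (fun x => F (e.symm x) - pullback e (fun x => φ x * u x) (e.symm x)) 2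
          (volume.restrict (tsupport φ))
        ≤ C₁ * (ENNReal.ofReal B * ENNReal.ofReal ε) := by
          gcongr
          refine h1.trans ?_
          gcongr
          exact (eLpNorm_restrict_le _ _ _ _).trans hu
      _ = ENNReal.ofReal (C₁ * B * ε) := by
          rw [mul_assoc, ENNReal.ofReal_mul hC₁₀, ENNReal.ofReal_coe_nnreal,
            ENNReal.ofReal_mul hB0]
  have hFmem : MemLp F 2 (vol g) := (Lp.memLp f).indicator hS
  have hDmem : MemLp (fun p => F p - pullback e (fun x => φ x * u x) p) 2 (vol g) :=
    ⟨(hFm.measurable.sub hq).aestronglyMeasurable, hdiff.trans_lt ENNReal.ofReal_lt_top⟩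
  have hqmem : MemLp (pullback e fun x => φ x * u x) 2 (vol g) := by
    have := hFmem.sub hDmem
    refine this.congr_norm hq.aestronglyMeasurable (Eventually.of_forall fun p => ?_)
    simp
  refine ⟨u, hqmem.toLp _, hqmem.coeFn_toLp, ?_, ?_⟩
  · rw [indicatorOp_apply]
    change ‖hFmem.toLp _ - hqmem.toLp _‖ ≤ _
    rw [← MemLp.toLp_sub, Lp.norm_toLp]
    refine (ENNReal.toReal_le_of_le_ofReal (by positivity) hdiff).trans ?_
    nlinarith [mul_nonneg hC₂₀ hε.le]
  · have hu' : (u : Euc n → ℂ) = w - fun x => w x - u x := by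
      funext x; simp
    rw [hu']
    refine (eLpNorm_sub_le hwm.1 (hwm.1.sub u.continuous.aestronglyMeasurable) (by norm_num)).trans ?_
    refine (add_le_add hwn hu).trans ?_
    rw [← ENNReal.ofReal_add (by positivity) hε.le]
    refine ENNReal.ofReal_le_ofReal ?_
    nlinarith [mul_nonneg (mul_nonneg hC₁₀ hB0) (norm_nonneg f)]

/-- Closeness of the local symbols of two operators, with finitely many `x`-derivatives, gives
closeness of the operators in operator norm, locally. -/
theorem exists_opNorm_indicator_sub_le (g : RiemMetric n M) {e : OpenPartialHomeomorph M (Euc n)}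
    (he : e ∈ charts n M) {φ : Euc n → ℂ} (hφ : IsCutoff e.target φ) {K : Set (Euc n)}
    (hK : IsCompact K) (hKe : K ⊆ e.target) (hφK : ∀ x ∈ K, φ x = 1)
    {S S' : Set M} (hS : MeasurableSet S) (hSK : S ⊆ e.symm '' K)
    (hS' : MeasurableSet S') (hSK' : S' ⊆ e.symm '' K) :
    ∃ C : ℝ, 0 ≤ C ∧ ∀ (A A' : L2 g →L[ℂ] L2 g) (a a' : Euc n → Euc n → ℂ),
      IsLocalSymbol g A e φ φ a → IsLocalSymbol g A' e φ φ a' → ∀ η : ℝ, 0 ≤ η →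
      (∀ k ≤ n + 1, ∀ x ∈ tsupport φ, ∀ ξ,
        ‖iteratedFDeriv ℝ k (fun y => a y ξ - a' y ξ) x‖ ≤ η) →
      ‖(indicatorOp g hS).comp ((A - A').comp (indicatorOp g hS'))‖ ≤ C * η := by
  obtain ⟨C₁, hC₁, h₁⟩ := exists_norm_indicator_sub_le g he hφ hK hKe hφK hS hSK
  obtain ⟨C₂, hC₂, h₂⟩ := exists_schwartz_approx g he hφ hK hKe hφK hS' hSK'
  refine ⟨C₁ * C₂, by positivity, fun A A' a a' ha ha' η hη0 hη => ?_⟩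
  refine ContinuousLinearMap.opNorm_le_bound _ (by positivity) fun f => ?_
  -- The approximation error is bounded only through `‖A - A'‖`, which `η` does not control; it
  -- disappears because `ε → 0` with `A`, `A'` and `f` fixed.
  have key : ∀ ε : ℝ, 0 < ε → ‖indicatorOp g hS ((A - A') (indicatorOp g hS' f))‖ ≤
      C₁ * C₂ * η * ‖f‖ + (C₁ * η + ‖A - A'‖ * C₂) * ε := by
    intro ε hε
    obtain ⟨u, f', hf', hd, hu⟩ := h₂ f ε hε
    have hmain := h₁ A A' a a' ha ha' η hη0 hη u f' hf'
    have hm : ‖indicatorOp g hS ((A - A') f')‖ ≤ C₁ * η * (C₂ * ‖f‖ + ε) := by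
      have h3 : ‖indicatorOp g hS ((A - A') f')‖ₑ ≤ ENNReal.ofReal (C₁ * η * (C₂ * ‖f‖ + ε)) := by
        rw [ENNReal.ofReal_mul (by positivity)]
        exact hmain.trans (by gcongr)
      rw [← ofReal_norm] at h3
      exact (ENNReal.ofReal_le_ofReal_iff (by positivity)).mp h3
    have hrest : ‖indicatorOp g hS ((A - A') (indicatorOp g hS' f - f'))‖ ≤
        ‖A - A'‖ * (C₂ * ε) :=
      (norm_indicatorOp_apply_le g hS _).trans ((ContinuousLinearMap.le_opNorm _ _).trans
        (by gcongr))
    have hsplit : indicatorOp g hS ((A - A') (indicatorOp g hS' f)) =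
        indicatorOp g hS ((A - A') f') +
          indicatorOp g hS ((A - A') (indicatorOp g hS' f - f')) := by
      rw [← map_add, ← map_add, add_sub_cancel]
    rw [hsplit]
    refine (norm_add_le _ _).trans ((add_le_add hm hrest).trans_eq ?_)
    ring
  change ‖indicatorOp g hS ((A - A') (indicatorOp g hS' f))‖ ≤ _
  refine le_of_forall_pos_le_add fun δ hδ => ?_
  set Z := C₁ * η + ‖A - A'‖ * C₂ with hZ
  have hZ0 : 0 ≤ Z := by positivity
  refine (key (δ / (Z + 1)) (by positivity)).trans ?_
  have : Z * (δ / (Z + 1)) ≤ δ := by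
    rw [← mul_div_assoc, div_le_iff₀ (by positivity)]
    nlinarith
  linarith

end LocalEstimate

/-! ### Separability of the localized operators. -/

section Separability

theorem isSeparable_of_countable_net {E : Type*} [PseudoMetricSpace E] {S : Set E}
    (h : ∀ ε : ℝ, 0 < ε → ∃ t : Set E, t.Countable ∧ ∀ x ∈ S, ∃ y ∈ t, dist x y ≤ ε) :
    TopologicalSpace.IsSeparable S := by
  obtain ⟨t, -, htc, ht⟩ := EMetric.subset_countable_closure_of_almost_dense_set S fun ε hε => by
    obtain ⟨r, hr0, hrε⟩ := ENNReal.lt_iff_exists_nnreal_btwn.mp hε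
    obtain ⟨t, htc, ht⟩ := h r (by exact_mod_cast hr0)
    refine ⟨t, htc, fun x hx => ?_⟩
    obtain ⟨y, hy, hxy⟩ := ht x hx
    refine Set.mem_biUnion hy (Metric.mem_closedEBall.mpr (le_trans ?_ hrε.le))
    rw [edist_dist, ← ENNReal.ofReal_coe_nnreal]
    exact ENNReal.ofReal_le_ofReal hxy
  exact ⟨t, htc, ht⟩

/-- The index set carries no topology: a countable dense subset of the range is lifted to indices.
-/
theorem exists_countable_net_of_map {I Y : Type*} [PseudoMetricSpace Y]
    [SecondCountableTopology Y] (F : I → Y) {δ : ℝ} (hδ : 0 < δ) :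
    ∃ t : Set I, t.Countable ∧ ∀ i, ∃ j ∈ t, dist (F i) (F j) < δ := by
  obtain ⟨D, hDsub, hDc, hD⟩ :=
    (TopologicalSpace.IsSeparable.of_separableSpace (Set.range F)).exists_countable_dense_subset
  have hc : Countable D := hDc.to_subtype
  choose s hs using fun y : D => hDsub y.2
  refine ⟨Set.range s, Set.countable_range s, fun i => ?_⟩
  obtain ⟨y, hy, hxy⟩ := Metric.mem_closure_iff.mp (hD ⟨i, rfl⟩) δ hδ
  exact ⟨s ⟨y, hy⟩, ⟨_, rfl⟩, by rwa [hs ⟨y, hy⟩]⟩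

variable {n : ℕ}

instance (k : ℕ) : SecondCountableTopology (Euc n [×k]→L[ℝ] ℂ) := by
  have : FiniteDimensional ℝ (Euc n [×k]→L[ℝ] ℂ) :=
    FiniteDimensional.of_injective
      (ContinuousMultilinearMap.toMultilinearMapLinear :
        (Euc n [×k]→L[ℝ] ℂ) →ₗ[ℝ] MultilinearMap ℝ (fun _ : Fin k => Euc n) ℂ)
      ContinuousMultilinearMap.toMultilinearMap_injective
  have : ProperSpace (Euc n [×k]→L[ℝ] ℂ) := FiniteDimensional.proper ℝ _
  exact secondCountable_of_proper

/-- The `x`-derivatives are the joint derivative restricted to vectors of the first factor. -/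
theorem continuous_partial_iteratedFDeriv {a : Euc n → Euc n → ℂ}
    (ha : ContDiff ℝ ∞ fun z : Euc n × Euc n => a z.1 z.2) (k : ℕ) :
    Continuous fun z : Euc n × Euc n => iteratedFDeriv ℝ k (fun y => a y z.2) z.1 := by
  set f : Euc n × Euc n → ℂ := fun z => a z.1 z.2 with hf
  have h : ∀ z : Euc n × Euc n, iteratedFDeriv ℝ k (fun y => a y z.2) z.1 =
      (iteratedFDeriv ℝ k f z).compContinuousLinearMap
        fun _ => ContinuousLinearMap.inl ℝ (Euc n) (Euc n) := by
    intro z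
    have h1 := (ContinuousLinearMap.inl ℝ (Euc n) (Euc n)).iteratedFDeriv_comp_right
      (f := fun w => f (w + (0, z.2))) (n := ∞)
      (ha.comp (contDiff_id.add contDiff_const)) z.1 (i := k) (by exact_mod_cast le_top)
    rw [iteratedFDeriv_comp_add_right] at h1
    have h2 : (fun w => f (w + (0, z.2))) ∘ ContinuousLinearMap.inl ℝ (Euc n) (Euc n) =
        fun y => a y z.2 := by
      funext y
      simp [hf]
    rw [h2] at h1
    rw [h1]
    simp
  simp_rw [h]
  exact (ContinuousMultilinearMap.compContinuousLinearMapL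
    (fun _ : Fin k => ContinuousLinearMap.inl ℝ (Euc n) (Euc n))).continuous.comp
    (ha.continuous_iteratedFDeriv (by exact_mod_cast le_top))

/-- The symbol `a` approaches a function that is homogeneous of degree zero at rate
`m (1 + |ξ|)⁻¹`, together with its `x`-derivatives up to order `n + 1`. -/
def HasRadialLimit (a : Euc n → Euc n → ℂ) (m : ℕ) : Prop :=
  ∃ a₀ : Euc n → Euc n → ℂ, (∀ x ξ, ξ ≠ 0 → ∀ t : ℝ, 0 < t → a₀ x (t • ξ) = a₀ x ξ) ∧
    (∀ ξ, ξ ≠ 0 → ContDiff ℝ ∞ fun x => a₀ x ξ) ∧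
    ∀ k ≤ n + 1, ∀ x ξ, 1 ≤ ‖ξ‖ →
      ‖iteratedFDeriv ℝ k (fun y => a y ξ - a₀ y ξ) x‖ ≤ m * (1 + ‖ξ‖)⁻¹

/-- The expansion cut at `J = 1`: `a - a₀` is of order `-1`. The constant is rounded up to a natural
number so that countably many classes exhaust the classical symbols. -/
theorem IsClassicalSymbol.exists_hasRadialLimit {a : Euc n → Euc n → ℂ}
    (ha : IsClassicalSymbol a) : ∃ m : ℕ, HasRadialLimit a m := by
  obtain ⟨aj, hsm, hhom, hest⟩ := ha.expansion
  have h1 := hest 1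
  choose C hC using fun k => h1 k 0
  obtain ⟨m, hm⟩ := exists_nat_ge (∑ k ∈ Finset.range (n + 2), |C k|)
  refine ⟨m, aj 0, fun x ξ hξ t ht => by simpa using hhom 0 x ξ hξ t ht, fun ξ hξ => ?_,
    fun k hk x ξ hξ => ?_⟩
  · refine contDiff_iff_contDiffAt.mpr fun x => ?_
    have ho : IsOpen {z : Euc n × Euc n | z.2 ≠ 0} :=
      isOpen_ne_fun continuous_snd continuous_const
    exact ((hsm 0).contDiffAt (ho.mem_nhds (show ((x, ξ) : Euc n × Euc n).2 ≠ 0 from hξ))).comp x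
      (contDiffAt_id.prodMk contDiffAt_const)
  · have h2 := hC k x ξ hξ
    simp only [norm_iteratedFDeriv_zero, Finset.range_one, Finset.sum_singleton, Nat.cast_one,
      Nat.cast_zero, sub_zero, zpow_neg_one] at h2
    refine h2.trans (mul_le_mul_of_nonneg_right ?_ (by positivity))
    refine (le_abs_self _).trans (le_trans ?_ hm)
    exact Finset.single_le_sum (f := fun k => |C k|) (fun _ _ => abs_nonneg _)
      (Finset.mem_range.mpr (by omega))

theorem iteratedFDeriv_fun_sub {f h : Euc n → ℂ} (hf : ContDiff ℝ ∞ f) (hh : ContDiff ℝ ∞ h)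
    (k : ℕ) (x : Euc n) : iteratedFDeriv ℝ k (fun y => f y - h y) x =
      iteratedFDeriv ℝ k f x - iteratedFDeriv ℝ k h x :=
  iteratedFDeriv_sub_apply (hf.contDiffAt.of_le (by exact_mod_cast le_top))
    (hh.contDiffAt.of_le (by exact_mod_cast le_top))

theorem IsClassicalSymbol.contDiff_left {a : Euc n → Euc n → ℂ} (ha : IsClassicalSymbol a)
    (ξ : Euc n) : ContDiff ℝ ∞ fun x => a x ξ :=
  ha.smooth.comp (contDiff_id.prodMk contDiff_const)

/-- Outside a large ball, the `x`-derivatives of a symbol differ little from their values at the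
radial projection to the sphere. -/
theorem HasRadialLimit.norm_sub_le {a : Euc n → Euc n → ℂ} {m : ℕ} (h : HasRadialLimit a m)
    (ha : IsClassicalSymbol a) {R : ℝ} (hR : 1 ≤ R) {ξ : Euc n} (hξ : R ≤ ‖ξ‖) {k : ℕ}
    (hk : k ≤ n + 1) (x : Euc n) :
    ‖iteratedFDeriv ℝ k (fun y => a y ξ) x -
      iteratedFDeriv ℝ k (fun y => a y ((R / ‖ξ‖) • ξ)) x‖ ≤ 2 * m * (1 + R)⁻¹ := by
  obtain ⟨a₀, hhom, hsm, hest⟩ := h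
  have hξ0 : 0 < ‖ξ‖ := by linarith
  have hξne : ξ ≠ 0 := norm_pos_iff.mp hξ0
  set ζ := (R / ‖ξ‖) • ξ with hζ
  have hζn : ‖ζ‖ = R := by
    rw [hζ, norm_smul, Real.norm_of_nonneg (by positivity)]
    field_simp
  have hζne : ζ ≠ 0 := norm_pos_iff.mp (by rw [hζn]; linarith)
  have heq : (fun y => a₀ y ζ) = fun y => a₀ y ξ :=
    funext fun y => hhom y ξ hξne _ (by positivity)
  have h1 := hest k hk x ξ (hR.trans hξ)
  have h2 := hest k hk x ζ (by rw [hζn]; exact hR)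
  rw [iteratedFDeriv_fun_sub (ha.contDiff_left _) (hsm _ hξne)] at h1
  rw [iteratedFDeriv_fun_sub (ha.contDiff_left _) (hsm _ hζne), heq, hζn] at h2
  have h3 : (m : ℝ) * (1 + ‖ξ‖)⁻¹ ≤ m * (1 + R)⁻¹ := by gcongr
  calc _ = ‖(iteratedFDeriv ℝ k (fun y => a y ξ) x - iteratedFDeriv ℝ k (fun y => a₀ y ξ) x) -
        (iteratedFDeriv ℝ k (fun y => a y ζ) x - iteratedFDeriv ℝ k (fun y => a₀ y ξ) x)‖ := by
        congr 1; abel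
    _ ≤ _ := (_root_.norm_sub_le _ _).trans (by linarith)

/-- Outside the ball, `ξ` is replaced by its radial projection to the sphere of radius `R`, at a
cost of `2m / (1 + R)` for each of the two symbols. -/
theorem norm_iteratedFDeriv_sub_le_of_ball {a a' : Euc n → Euc n → ℂ} {m : ℕ}
    (h : HasRadialLimit a m) (h' : HasRadialLimit a' m) (ha : IsClassicalSymbol a)
    (ha' : IsClassicalSymbol a') {R δ : ℝ} (hR : 1 ≤ R) {k : ℕ} (hk : k ≤ n + 1) {x : Euc n}
    (hball : ∀ ξ : Euc n, ‖ξ‖ ≤ R → ‖iteratedFDeriv ℝ k (fun y => a y ξ) x -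
      iteratedFDeriv ℝ k (fun y => a' y ξ) x‖ ≤ δ) (ξ : Euc n) :
    ‖iteratedFDeriv ℝ k (fun y => a y ξ - a' y ξ) x‖ ≤ δ + 4 * m * (1 + R)⁻¹ := by
  rw [iteratedFDeriv_fun_sub (ha.contDiff_left _) (ha'.contDiff_left _)]
  rcases le_total ‖ξ‖ R with hξ | hξ
  · have : 0 ≤ 4 * (m : ℝ) * (1 + R)⁻¹ := by positivity
    linarith [hball ξ hξ]
  · have hξ0 : 0 < ‖ξ‖ := by linarith
    set ζ := (R / ‖ξ‖) • ξ with hζ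
    have hζn : ‖ζ‖ ≤ R := by
      rw [hζ, norm_smul, Real.norm_of_nonneg (by positivity)]
      exact le_of_eq (by field_simp)
    have h1 := h.norm_sub_le ha hR hξ hk x
    have h2 := h'.norm_sub_le ha' hR hξ hk x
    have h3 := hball ζ hζn
    rw [← hζ] at h1 h2
    set p := iteratedFDeriv ℝ k (fun y => a y ξ) x
    set q := iteratedFDeriv ℝ k (fun y => a' y ξ) x
    set p' := iteratedFDeriv ℝ k (fun y => a y ζ) x
    set q' := iteratedFDeriv ℝ k (fun y => a' y ζ) x
    have e : p - q = (p - p') + (p' - q') - (q - q') := by abel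
    rw [e]
    have := norm_sub_le ((p - p') + (p' - q')) (q - q')
    have := norm_add_le (p - p') (p' - q')
    linarith

variable {M : Type*} [TopologicalSpace M] [ChartedSpace (Euc n) M] [IsManifold (𝓡 n) ∞ M]
  [MeasurableSpace M] [BorelSpace M] [T2Space M]

/-- The part of `Ψ⁰(M)` with kernel localized in a compact subset of a chart is separable in
operator norm. -/
theorem isSeparable_image_indicatorOp (g : RiemMetric n M) {e : OpenPartialHomeomorph M (Euc n)}
    (he : e ∈ charts n M) {φ : Euc n → ℂ} (hφ : IsCutoff e.target φ) {K : Set (Euc n)}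
    (hK : IsCompact K) (hKe : K ⊆ e.target) (hφK : ∀ x ∈ K, φ x = 1)
    {S S' : Set M} (hS : MeasurableSet S) (hSK : S ⊆ e.symm '' K)
    (hS' : MeasurableSet S') (hSK' : S' ⊆ e.symm '' K) :
    TopologicalSpace.IsSeparable
      ((fun A => (indicatorOp g hS).comp (A.comp (indicatorOp g hS'))) '' Psi0 g) := by
  obtain ⟨C, hC0, hC⟩ := exists_opNorm_indicator_sub_le g he hφ hK hKe hφK hS hSK hS' hSK'
  set T : (L2 g →L[ℂ] L2 g) → (L2 g →L[ℂ] L2 g) :=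
    fun A => (indicatorOp g hS).comp (A.comp (indicatorOp g hS')) with hT
  have hTsub : ∀ A A', T A - T A' = (indicatorOp g hS).comp ((A - A').comp (indicatorOp g hS')) := by
    intro A A'
    ext1 f
    simp [hT]
  refine isSeparable_of_countable_net fun ε hε => ?_
  have hnet : ∀ m : ℕ, ∃ t : Set (L2 g →L[ℂ] L2 g), t.Countable ∧
      ∀ (A : L2 g →L[ℂ] L2 g) (a : Euc n → Euc n → ℂ), IsLocalSymbol g A e φ φ a →
        HasRadialLimit a m → ∃ A' ∈ t, dist (T A) A' ≤ ε := by
    intro m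
    -- `δ` is spent twice, on the ball and on the radial tail, and `C (δ + δ) ≤ ε`; `R` is chosen so
    -- that the tail `4m / (1 + R)` is at most `δ`.
    set δ : ℝ := ε / (2 * (C + 1)) with hδ
    have hδ0 : 0 < δ := by positivity
    set R : ℝ := 1 + 4 * m / δ with hR
    have hR1 : 1 ≤ R := le_add_of_nonneg_right (by positivity)
    have hRδ : 4 * m * (1 + R)⁻¹ ≤ δ := by
      rw [← div_eq_mul_inv, div_le_iff₀ (by positivity)]
      have : δ * R = δ + 4 * m := by rw [hR]; field_simp
      nlinarith
    set L := tsupport φ with hL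
    have hcL : CompactSpace L := isCompact_iff_compactSpace.mp hφ.compact.isCompact
    have hcB : CompactSpace (Metric.closedBall (0 : Euc n) R) :=
      isCompact_iff_compactSpace.mp (isCompact_closedBall _ _)
    -- Operators are indexed together with a choice of symbol, so uniqueness of the local symbol is
    -- not needed. `F` records the `x`-derivatives on a compact set, with values in a second
    -- countable space.
    let I := {p : (L2 g →L[ℂ] L2 g) × (Euc n → Euc n → ℂ) //
      IsLocalSymbol g p.1 e φ φ p.2 ∧ HasRadialLimit p.2 m}
    let F : I → (k : Fin (n + 2)) →
        C(L × Metric.closedBall (0 : Euc n) R, Euc n [×(k : ℕ)]→L[ℝ] ℂ) := fun i k =>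
      ⟨fun z => iteratedFDeriv ℝ (k : ℕ) (fun y => i.1.2 y z.2) z.1,
        (continuous_partial_iteratedFDeriv i.2.1.1.smooth k).comp
          ((continuous_subtype_val.comp continuous_fst).prodMk
            (continuous_subtype_val.comp continuous_snd))⟩
    obtain ⟨t, htc, ht⟩ := exists_countable_net_of_map F hδ0
    refine ⟨(fun i : I => T i.1.1) '' t, htc.image _, fun A a hA ha => ?_⟩
    obtain ⟨j, hjt, hj⟩ := ht ⟨(A, a), hA, ha⟩
    refine ⟨T j.1.1, ⟨j, hjt, rfl⟩, ?_⟩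
    rw [dist_eq_norm, hTsub]
    have hder : ∀ k ≤ n + 1, ∀ x ∈ tsupport φ, ∀ ξ,
        ‖iteratedFDeriv ℝ k (fun y => a y ξ - j.1.2 y ξ) x‖ ≤ δ + δ := by
      intro k hk x hx ξ
      refine (norm_iteratedFDeriv_sub_le_of_ball ha j.2.2 hA.1 j.2.1.1 hR1 hk (δ := δ)
        (fun ζ hζ => ?_) ξ).trans (by linarith)
      have h1 := (dist_le_pi_dist _ _ (⟨k, by omega⟩ : Fin (n + 2))).trans hj.le
      have h2 := (ContinuousMap.dist_apply_le_dist
        ((⟨x, hx⟩, ⟨ζ, mem_closedBall_zero_iff.mpr hζ⟩) :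
          L × Metric.closedBall (0 : Euc n) R)).trans h1
      rwa [dist_eq_norm] at h2
    refine (hC A j.1.1 a j.1.2 hA j.2.1 (δ + δ) (by positivity) hder).trans ?_
    have : C * (δ + δ) = ε * (C / (C + 1)) := by rw [hδ]; field_simp; ring
    rw [this]
    exact mul_le_of_le_one_right hε.le ((div_le_one (by positivity)).mpr (by linarith))
  choose t htc ht using hnet
  refine ⟨⋃ m, t m, Set.countable_iUnion htc, ?_⟩
  rintro _ ⟨A, hA, rfl⟩
  obtain ⟨a, ha⟩ := hA e he φ φ hφ hφ
  obtain ⟨m, hm⟩ := ha.1.exists_hasRadialLimit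
  obtain ⟨A', hA', hd⟩ := ht m A a ha hm
  exact ⟨A', Set.mem_iUnion.mpr ⟨m, hA'⟩, hd⟩

end Separability

/-! ### Disconnected charts that contain two given points. -/

section CommonCharts

variable {n : ℕ} {M : Type*} [TopologicalSpace M] [ChartedSpace (Euc n) M] [IsManifold (𝓡 n) ∞ M]

theorem translate_mem_charts {e : OpenPartialHomeomorph M (Euc n)} (he : e ∈ charts n M)
    (c : Euc n) : e.transHomeomorph (Homeomorph.addRight c) ∈ charts n M := by
  have h : ∀ c : Euc n, ContMDiff (𝓡 n) (𝓡 n) ∞ (Homeomorph.addRight c) := fun c =>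
    (contDiff_id.add contDiff_const : ContDiff ℝ ∞ fun x : Euc n => x + c).contMDiff
  have h' : ContMDiff (𝓡 n) (𝓡 n) ∞ (Homeomorph.addRight c).symm :=
    (contDiff_id.add contDiff_const : ContDiff ℝ ∞ fun x : Euc n => x + -c).contMDiff
  refine OpenPartialHomeomorph.mem_maximalAtlas_of_contMDiffOn _ ?_ ?_
  · exact (h c).comp_contMDiffOn (contMDiffOn_of_mem_maximalAtlas he)
  · exact (contMDiffOn_symm_of_mem_maximalAtlas he).comp h'.contMDiffOn fun x hx => hx

open Classical in
theorem disjointUnion_mem_charts {e e' : OpenPartialHomeomorph M (Euc n)} (he : e ∈ charts n M)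
    (he' : e' ∈ charts n M) (hs : Disjoint e.source e'.source)
    (ht : Disjoint e.target e'.target) : e.disjointUnion e' hs ht ∈ charts n M := by
  refine OpenPartialHomeomorph.mem_maximalAtlas_of_contMDiffOn _ ?_ ?_
  · change ContMDiffOn (𝓡 n) (𝓡 n) ∞ (e.source.piecewise e e') (e.source ∪ e'.source)
    refine ContMDiffOn.union_of_isOpen ?_ ?_ e.open_source e'.open_source
    · exact (contMDiffOn_of_mem_maximalAtlas he).congr fun x hx =>
        Set.piecewise_eq_of_mem _ _ _ hx
    · exact (contMDiffOn_of_mem_maximalAtlas he').congr fun x hx =>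
        Set.piecewise_eq_of_notMem _ _ _ (Set.disjoint_right.mp hs hx)
  · change ContMDiffOn (𝓡 n) (𝓡 n) ∞ (e.target.piecewise e.symm e'.symm) (e.target ∪ e'.target)
    refine ContMDiffOn.union_of_isOpen ?_ ?_ e.open_target e'.open_target
    · exact (contMDiffOn_symm_of_mem_maximalAtlas he).congr fun x hx =>
        Set.piecewise_eq_of_mem _ _ _ hx
    · exact (contMDiffOn_symm_of_mem_maximalAtlas he').congr fun x hx =>
        Set.piecewise_eq_of_notMem _ _ _ (Set.disjoint_right.mp ht hx)

/-- A small chart around a point, inside a given neighbourhood, with target in a unit ball. -/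
theorem exists_small_chart {p : M} {U : Set M} (hU : IsOpen U) (hp : p ∈ U) :
    ∃ e ∈ charts n M, p ∈ e.source ∧ e.source ⊆ U ∧ ∃ c : Euc n, e.target ⊆ Metric.ball c 1 := by
  set f := chartAt (Euc n) p with hf
  set s : Set M := U ∩ (f.source ∩ f ⁻¹' Metric.ball (f p) 1) with hs
  have hso : IsOpen s := hU.inter (f.isOpen_inter_preimage Metric.isOpen_ball)
  have hps : p ∈ s := ⟨hp, mem_chart_source _ _, Metric.mem_ball_self one_pos⟩
  refine ⟨f.restr s, restr_mem_maximalAtlas _ (IsManifold.chart_mem_maximalAtlas p) hso,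
    ?_, ?_, f p, ?_⟩
  · rw [f.restr_source' s hso]
    exact ⟨mem_chart_source _ _, hps⟩
  · rw [f.restr_source' s hso]
    exact fun x hx => hx.2.1
  · intro y hy
    have h1 := (f.restr s).map_target hy
    rw [f.restr_source' s hso] at h1
    have h2 : f ((f.restr s).symm y) ∈ Metric.ball (f p) 1 := h1.2.2.2
    have h3 : (f.restr s) ((f.restr s).symm y) = y := (f.restr s).right_inv hy
    have h4 : f ((f.restr s).symm y) = y := h3
    rwa [h4] at h2

/-- In positive dimension, two points of a manifold lie in the domain of a common (possibly
disconnected) chart. -/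
theorem exists_common_chart [T2Space M] (hn : 0 < n) (p q : M) :
    ∃ e ∈ charts n M, p ∈ e.source ∧ q ∈ e.source := by
  by_cases hpq : p = q
  · subst hpq
    exact ⟨chartAt _ p, IsManifold.chart_mem_maximalAtlas p, mem_chart_source _ _,
      mem_chart_source _ _⟩
  obtain ⟨U, W, hU, hW, hpU, hqW, hUW⟩ := t2_separation hpq
  obtain ⟨e, he, hpe, heU, c, hc⟩ := exists_small_chart (n := n) hU hpU
  obtain ⟨e', he', hqe, heW, c', hc'⟩ := exists_small_chart (n := n) hW hqW
  -- Moving the second target into the unit ball about `c + v`, with `‖v‖ = 2`, makes the two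
  -- targets disjoint. Positive dimension provides such a `v`.
  set v : Euc n := EuclideanSpace.single ⟨0, hn⟩ 2 with hv
  have hvn : ‖v‖ = 2 := by simp [hv]
  set e'' := e'.transHomeomorph (Homeomorph.addRight (c - c' + v)) with he''
  have hs : Disjoint e.source e''.source := hUW.mono heU heW
  have ht : Disjoint e.target e''.target := by
    refine Set.disjoint_left.mpr fun y hy hy' => ?_
    have h1 := Metric.mem_ball.mp (hc hy)
    have h2 : (Homeomorph.addRight (c - c' + v)).symm y ∈ e'.target := hy'
    have h3 := Metric.mem_ball.mp (hc' h2)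
    have h4 : (Homeomorph.addRight (c - c' + v)).symm y = y + -(c - c' + v) := rfl
    rw [h4, dist_eq_norm] at h3
    rw [dist_eq_norm] at h1
    have h5 : v = (y - c) - (y + -(c - c' + v) - c') := by abel
    have h6 := norm_sub_le (y - c) (y + -(c - c' + v) - c')
    rw [← h5, hvn] at h6
    linarith
  classical
  exact ⟨e.disjointUnion e'' hs ht, disjointUnion_mem_charts he (translate_mem_charts he' _) hs ht,
    Or.inl hpe, Or.inr hqe⟩

/-- A finite cover of a compact manifold by compact sets, any two of which lie in a common chart
domain. -/
theorem exists_compact_cover [T2Space M] [CompactSpace M] (hn : 0 < n) :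
    ∃ (m : ℕ) (K : ℕ → Set M), (∀ i, IsCompact (K i)) ∧ (∀ p, ∃ i < m, p ∈ K i) ∧
      ∀ i < m, ∀ j < m, ∃ e ∈ charts n M, K i ⊆ e.source ∧ K j ⊆ e.source := by
  have : SecondCountableTopology M := ChartedSpace.secondCountable_of_sigmaCompact (Euc n) M
  let _ : MetricSpace M := TopologicalSpace.metrizableSpaceMetric M
  -- The Lebesgue number is taken on `M × M`, covered by the squares of chart domains, so that one
  -- chart contains the closed `δ / 2`-balls about any two centres.
  obtain ⟨δ, hδ, hleb⟩ := lebesgue_number_lemma_of_metric (s := (Set.univ : Set (M × M)))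
    (c := fun e : charts n M => e.1.source ×ˢ e.1.source) isCompact_univ
    (fun e => e.1.open_source.prod e.1.open_source) (fun z _ => by
      obtain ⟨e, he, h1, h2⟩ := exists_common_chart hn z.1 z.2
      exact Set.mem_iUnion.mpr ⟨⟨e, he⟩, h1, h2⟩)
  obtain ⟨t, -, htf, ht⟩ := finite_cover_balls_of_compact (isCompact_univ (X := M)) (half_pos hδ)
  obtain ⟨m, f, -, hf⟩ := htf.fin_param
  refine ⟨m, fun i => if h : i < m then Metric.closedBall (f ⟨i, h⟩) (δ / 2) else ∅,
    fun i => ?_, fun p => ?_, fun i hi j hj => ?_⟩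
  · dsimp only
    split_ifs
    · exact Metric.isClosed_closedBall.isCompact
    · exact isCompact_empty
  · obtain ⟨x, hx, hpx⟩ := Set.mem_iUnion₂.mp (ht (Set.mem_univ p))
    rw [← hf] at hx
    obtain ⟨i, rfl⟩ := hx
    refine ⟨i, i.2, ?_⟩
    beta_reduce
    rw [dif_pos i.2]
    exact Metric.ball_subset_closedBall hpx
  · obtain ⟨⟨e, he⟩, hz⟩ := hleb (f ⟨i, hi⟩, f ⟨j, hj⟩) (Set.mem_univ _)
    have hsub : ∀ x y : M, dist x (f ⟨i, hi⟩) ≤ δ / 2 → dist y (f ⟨j, hj⟩) ≤ δ / 2 →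
        x ∈ e.source ∧ y ∈ e.source := by
      intro x y hx hy
      have : (x, y) ∈ Metric.ball (f ⟨i, hi⟩, f ⟨j, hj⟩) δ := by
        rw [Metric.mem_ball, Prod.dist_eq]
        exact max_lt (by simp only; linarith) (by simp only; linarith)
      exact hz this
    refine ⟨e, he, ?_, ?_⟩
    · beta_reduce
      rw [dif_pos hi]
      exact fun x hx => (hsub x (f ⟨j, hj⟩) hx (by rw [dist_self]; positivity)).1
    · beta_reduce
      rw [dif_pos hj]
      exact fun y hy => (hsub (f ⟨i, hi⟩) y (by rw [dist_self]; positivity) hy).2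

theorem exists_isCutoff_eq_one {V K : Set (Euc n)} (hV : IsOpen V) (hK : IsCompact K)
    (hKV : K ⊆ V) : ∃ φ, IsCutoff V φ ∧ ∀ x ∈ K, φ x = 1 := by
  obtain ⟨L, hL, hKL, hLV⟩ := exists_compact_between hK hV hKV
  obtain ⟨f, hf, -, hsupp, hone⟩ := exists_contMDiff_support_eq_eq_one_iff (n := ⊤) (𝓡 n)
    isOpen_interior hK.isClosed hKL
  have hts : tsupport (fun x => (f x : ℂ)) ⊆ L := by
    refine closure_minimal (fun x hx => ?_) hL.isClosed
    refine interior_subset (hsupp ▸ ?_ : x ∈ interior L)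
    intro h0
    exact hx (by simp [h0])
  exact ⟨fun x => (f x : ℂ), ⟨Complex.ofRealCLM.contDiff.comp hf.contDiff,
    hL.of_isClosed_subset (isClosed_tsupport _) hts, hts.trans hLV⟩,
    fun x hx => by beta_reduce; rw [(hone x).mp hx]; simp⟩

end CommonCharts

/-! ### Separability of `Ψ⁰(M)`. -/

section GlobalSeparability

variable {n : ℕ} {M : Type*} [TopologicalSpace M] [ChartedSpace (Euc n) M] [IsManifold (𝓡 n) ∞ M]
  [MeasurableSpace M]

theorem indicatorOp_add_of_disjoint (g : RiemMetric n M) {S T W : Set M} (hS : MeasurableSet S)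
    (hT : MeasurableSet T) (hW : MeasurableSet W) (hd : Disjoint S T) (hu : W = S ∪ T)
    (f : L2 g) : indicatorOp g hW f = indicatorOp g hS f + indicatorOp g hT f := by
  rw [indicatorOp_apply, indicatorOp_apply, indicatorOp_apply, ← MemLp.toLp_add,
    MemLp.toLp_eq_toLp_iff, hu, Set.indicator_union_of_disjoint hd]
  rfl

theorem indicatorOp_empty (g : RiemMetric n M) {S : Set M} (hS : MeasurableSet S) (h : S = ∅)
    (f : L2 g) : indicatorOp g hS f = 0 := by
  have := indicatorOp_add_of_disjoint g hS hS hS (by rw [h]; exact disjoint_bot_left)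
    (Set.union_self S).symm f
  exact left_eq_add.mp this

theorem indicatorOp_univ (g : RiemMetric n M) {S : Set M} (hS : MeasurableSet S)
    (h : S = Set.univ) (f : L2 g) : indicatorOp g hS f = f := by
  rw [indicatorOp_apply]
  conv_rhs => rw [← Lp.toLp_coeFn f (Lp.memLp f)]
  rw [MemLp.toLp_eq_toLp_iff, h, Set.indicator_univ]

theorem sum_indicatorOp_sdiff (g : RiemMetric n M) {K W : ℕ → Set M}
    (hW : ∀ k, MeasurableSet (W k)) (hB : ∀ i, MeasurableSet (K i \ W i)) (hzero : W 0 = ∅)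
    (hsucc : ∀ k, W (k + 1) = W k ∪ K k) (f : L2 g) (k : ℕ) :
    ∑ i ∈ Finset.range k, indicatorOp g (hB i) f = indicatorOp g (hW k) f := by
  induction k with
  | zero => rw [Finset.sum_range_zero, indicatorOp_empty g (hW 0) hzero]
  | succ k ih =>
    rw [Finset.sum_range_succ, ih]
    have hu : W (k + 1) = W k ∪ K k \ W k := by rw [hsucc, Set.union_sdiff_self]
    exact (indicatorOp_add_of_disjoint g (hW k) (hB k) (hW (k + 1))
      Set.disjoint_sdiff_right hu f).symm

theorem exists_sum_indicatorOp (g : RiemMetric n M) {m : ℕ} {K : ℕ → Set M}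
    (hK : ∀ i, MeasurableSet (K i)) (hcover : ∀ p, ∃ i < m, p ∈ K i) :
    ∃ (B : ℕ → Set M) (hB : ∀ i, MeasurableSet (B i)), (∀ i, B i ⊆ K i) ∧
      ∀ f : L2 g, ∑ i ∈ Finset.range m, indicatorOp g (hB i) f = f := by
  obtain ⟨W, hWm, hzero, hsucc, huniv⟩ : ∃ W : ℕ → Set M, (∀ k, MeasurableSet (W k)) ∧
      W 0 = ∅ ∧ (∀ k, W (k + 1) = W k ∪ K k) ∧ W m = Set.univ := by
    refine ⟨fun k => ⋃ j ∈ Finset.range k, K j,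
      fun k => Finset.measurableSet_biUnion _ fun j _ => hK j, by simp, fun k => ?_,
      Set.eq_univ_of_forall fun p => ?_⟩
    · simp only [Finset.range_add_one, Finset.set_biUnion_insert]
      exact Set.union_comm _ _
    · obtain ⟨i, hi, hp⟩ := hcover p
      exact Set.mem_biUnion (Finset.mem_range.mpr hi) hp
  refine ⟨fun i => K i \ W i, fun i => (hK i).diff (hWm i), fun i => Set.sdiff_subset,
    fun f => ?_⟩
  exact (sum_indicatorOp_sdiff g hWm (fun i => (hK i).diff (hWm i)) hzero hsucc f m).trans
    (indicatorOp_univ g (hWm m) huniv f)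

variable [BorelSpace M] [T2Space M] [CompactSpace M]

/-- For a measurable partition into sets `Bᵢ`, `A = ∑ 1_{Bᵢ} A 1_{Bⱼ}`. Each term belongs to a
separable set of localized operators, and the span of a separable set is separable; the terms
themselves need not lie in `Ψ⁰(M)`. -/
theorem isSeparable_Psi0_of_pos (hn : 0 < n) (g : RiemMetric n M) :
    TopologicalSpace.IsSeparable (Psi0 g) := by
  obtain ⟨m, K, hK, hcover, hchart⟩ := exists_compact_cover (n := n) (M := M) hn
  obtain ⟨B, hB, hBK, hsum⟩ :=
    exists_sum_indicatorOp g (fun i => (hK i).isClosed.measurableSet) hcover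
  set T : ℕ → ℕ → (L2 g →L[ℂ] L2 g) → (L2 g →L[ℂ] L2 g) := fun i j A =>
    (indicatorOp g (hB i)).comp (A.comp (indicatorOp g (hB j))) with hT
  have hloc : ∀ i < m, ∀ j < m, TopologicalSpace.IsSeparable (T i j '' Psi0 g) := by
    intro i hi j hj
    obtain ⟨e, he, hei, hej⟩ := hchart i hi j hj
    have hKc : IsCompact (e '' (K i ∪ K j)) :=
      ((hK i).union (hK j)).image_of_continuousOn
        (e.continuousOn.mono (Set.union_subset hei hej))
    have hKt : e '' (K i ∪ K j) ⊆ e.target := by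
      rintro _ ⟨p, hp, rfl⟩
      exact e.map_source (Set.union_subset hei hej hp)
    obtain ⟨φ, hφ, hφ1⟩ := exists_isCutoff_eq_one e.open_target hKc hKt
    have hsub : K i ∪ K j ⊆ e.symm '' (e '' (K i ∪ K j)) := fun p hp =>
      ⟨e p, ⟨p, hp, rfl⟩, e.left_inv (Set.union_subset hei hej hp)⟩
    exact isSeparable_image_indicatorOp g he hφ hKc hKt hφ1 (hB i)
      (((hBK i).trans Set.subset_union_left).trans hsub) (hB j)
      (((hBK j).trans Set.subset_union_right).trans hsub)
  have hun : TopologicalSpace.IsSeparable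
      (⋃ z : Fin m × Fin m, T z.1 z.2 '' Psi0 g) :=
    TopologicalSpace.IsSeparable.iUnion fun z => hloc _ z.1.2 _ z.2.2
  refine (hun.span (R := ℂ)).mono fun A hA => ?_
  have hdec : A = ∑ i ∈ Finset.range m, ∑ j ∈ Finset.range m, T i j A := by
    ext1 f
    simp only [sum_apply]
    have h1 : ∀ i, ∑ j ∈ Finset.range m, T i j A f = indicatorOp g (hB i) (A f) := by
      intro i
      conv_rhs => rw [← hsum f, map_sum, map_sum]
      rfl
    simp_rw [h1]
    exact (hsum _).symm
  rw [hdec]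
  refine Submodule.sum_mem _ fun i hi => Submodule.sum_mem _ fun j hj => Submodule.subset_span ?_
  exact Set.mem_iUnion.mpr ⟨(⟨i, Finset.mem_range.mp hi⟩, ⟨j, Finset.mem_range.mp hj⟩), A, hA, rfl⟩

/-- Evaluation at the points of nonzero mass is well defined on classes, and it is injective because
the remaining points form a null set. -/
theorem finiteDimensional_Lp_of_finite {X : Type*} [Finite X] [MeasurableSpace X]
    (μ : Measure X) : FiniteDimensional ℂ (Lp ℂ 2 μ) := by
  classical
  have hatom : ∀ {P : X → Prop}, (∀ᵐ x ∂μ, P x) → ∀ x, μ {x} ≠ 0 → P x := by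
    intro P hP x hx
    by_contra hne
    exact hx (measure_mono_null (Set.singleton_subset_iff.mpr hne) (ae_iff.mp hP))
  let ev : Lp ℂ 2 μ →ₗ[ℂ] (X → ℂ) :=
    { toFun := fun f x => if μ {x} = 0 then 0 else f x
      map_add' := fun f h => by
        funext x
        by_cases hx : μ {x} = 0
        · simp [hx]
        · simp only [hx, if_false, Pi.add_apply]
          exact hatom (Lp.coeFn_add f h) x hx
      map_smul' := fun c f => by
        funext x
        by_cases hx : μ {x} = 0
        · simp [hx]
        · simp only [hx, if_false, Pi.smul_apply, RingHom.id_apply]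
          exact hatom (Lp.coeFn_smul c f) x hx }
  refine FiniteDimensional.of_injective ev fun f h hfh => ?_
  refine Lp.ext ?_
  have hnull : ∀ᵐ x ∂μ, μ {x} ≠ 0 := by
    rw [ae_iff]
    have : {x | ¬ μ {x} ≠ 0} = ⋃ x ∈ {x | ¬ μ {x} ≠ 0}, {x} := by
      ext x; simp
    rw [this]
    exact (measure_biUnion_null_iff (Set.to_countable _)).mpr fun x hx => not_not.mp hx
  filter_upwards [hnull] with x hx
  have := congrFun hfh x
  simpa [ev, hx] using this

theorem isSeparable_Psi0 (g : RiemMetric n M) : TopologicalSpace.IsSeparable (Psi0 g) := by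
  rcases Nat.eq_zero_or_pos n with rfl | hn
  -- In dimension zero distinct points have no common chart, as `ℝ⁰` is a point. But then `M` is
  -- finite and `L²(M)` is finite-dimensional.
  · have hdisc : DiscreteTopology M := by
      refine discreteTopology_iff_isOpen_singleton.mpr fun p => ?_
      have : {p} = (chartAt (Euc 0) p).source := by
        refine Set.Subset.antisymm (Set.singleton_subset_iff.mpr (mem_chart_source _ _)) ?_
        intro q hq
        exact (chartAt (Euc 0) p).injOn hq (mem_chart_source _ _) (Subsingleton.elim _ _)
      rw [this]
      exact (chartAt (Euc 0) p).open_source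
    have hfin : Finite M := finite_of_compact_of_discrete
    have hfd : FiniteDimensional ℂ (L2 g) := finiteDimensional_Lp_of_finite (vol g)
    have : ProperSpace (L2 g →L[ℂ] L2 g) := FiniteDimensional.proper ℂ _
    exact TopologicalSpace.IsSeparable.of_separableSpace _
  · exact isSeparable_Psi0_of_pos hn g

end GlobalSeparability
end RandomONB

theorem theorem1 {n : ℕ} {M : Type*} [TopologicalSpace M] [T2Space M] [CompactSpace M]
    [ChartedSpace (RandomONB.Euc n) M] [IsManifold (𝓡 n) ∞ M]
    [MeasurableSpace M] [BorelSpace M]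
    (g : RandomONB.RiemMetric n M)
    (V : ℕ → Submodule ℂ (RandomONB.L2 g)) [∀ N, FiniteDimensional ℂ (V N)]
    (hdim : Tendsto (fun N => Module.finrank ℂ (V N)) atTop atTop)
    (hWeyl : RandomONB.LocalWeyl g V)
    (e : ∀ N, OrthonormalBasis (Fin (Module.finrank ℂ (V N))) ℂ (V N)) :
    ∀ᵐ U ∂(Measure.infinitePi fun N => RandomONB.haarUnitary (Module.finrank ℂ (V N))),
      RandomONB.IsQuantumErgodic (fun N => RandomONB.rotate (e N) (U N)) :=
  RandomONB.ae_isQuantumErgodic_of_isSeparable hdim hWeyl e (RandomONB.isSeparable_Psi0 g)
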